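/- Let $(\hat M,g)$ be a compact (Hausdorff, smooth, boundaryless) Riemannian 3-manifold, let $P_0\in\hat M$ and $M=\hat M\setminus\{P_0\}$. Let $\xi$ be a smooth unit vector field on $\hat M$ which is geodesible ($D_\xi\xi=0$ for the Levi-Civita connection $D$) and Killing ($\mathcal L_\xi g=0$). Let $f=Ric(\xi)$ be the Ricci curvature function along $\xi$, normalized as the average of the sectional curvatures of the planes containing $\xi$, i.e. $f=\frac12\,\mathrm{tr}\big(X\mapsto R(X,\xi)\xi\big)$ with $R(X,Y)=D_XD_Y-D_YD_X-D_{[X,Y]}$. Suppose that $f>0$ everywhere on $\hat M$ and that $f$ is equal to a constant $c$ outside a compact subset $K\subset M$. Then $\hat M\setminus K$ is Sasakian (up to the homothety determined by $c$), with $\xi$ as its Reeb direction, in the following sense. There is a smooth field $j$ of orthogonal complex structures on the plane field $\xi^\perp$ over $\hat M$ (the rotation by a right angle, for a suitable orientation) such that on $(\hat M\setminus K)\times(0,\infty)$, with coordinate $t$ on the second factor, the cone metric $$\bar g=t^2g+\frac1c\,dt\otimes dt$$ is Kähler with respect to the endomorphism $J$ given by $J|_{\xi^\perp}=j$, $J(\tfrac1t\xi)=\sqrt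 c\,\partial_t$, $J(\partial_t)=-\tfrac{1}{t\sqrt c}\,\xi$. That is, $\bar g$ is a smooth Riemannian metric, $J$ is a smooth integrable almost complex structure, $\bar g(J\cdot,J\cdot)=\bar g$, and $\Omega=\bar g(J\cdot,\cdot)$ satisfies $d\Omega=0$. -/

import Mathlib

open scoped Manifold ContDiff Bundle Topology

noncomputable section

namespace SasakiCone

section Riemannian

variable {E : Type*} [NormedAddCommGroup E] [NormedSpace ℝ E]
  {H : Type*} [TopologicalSpace H] {I : ModelWithCorners ℝ E H}
  {M : Type*} [TopologicalSpace M] [ChartedSpace H M] [IsManifold I ∞ M]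

/-- The right-hand side of the Koszul formula for `2 g(D_X Y, Z)` at `p`. -/
def koszul (g : Bundle.ContMDiffRiemannianMetric I ∞ E (fun p : M => TangentSpace I p))
    (X Y Z : Π p : M, TangentSpace I p) (p : M) : ℝ :=
  mvfderiv I (fun q => g.inner q (Y q) (Z q)) p (X p)
    + mvfderiv I (fun q => g.inner q (X q) (Z q)) p (Y p)
    - mvfderiv I (fun q => g.inner q (X q) (Y q)) p (Z p)
    + g.inner p (VectorField.mlieBracket I X Y p) (Z p)
    - g.inner p (VectorField.mlieBracket I X Z p) (Y p)
    - g.inner p (VectorField.mlieBracket I Y Z p) (X p)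

/-- The Levi-Civita derivative `D_X Y` at `p`: the (unique) tangent vector `w` at `p` that
satisfies the Koszul formula `2 g(w, Z) = koszul(X, Y, Z)` for all vector fields `Z`. -/
def leviCivita (g : Bundle.ContMDiffRiemannianMetric I ∞ E (fun p : M => TangentSpace I p))
    (X Y : Π p : M, TangentSpace I p) (p : M) : TangentSpace I p :=
  Classical.epsilon fun w : TangentSpace I p =>
    ∀ Z : Π q : M, TangentSpace I q, MDifferentiableAt I I.tangent (T% Z) p →
      2 * g.inner p w (Z p) = koszul g X Y Z p

/-- The curvature `R(X, Y) Z = D_X D_Y Z - D_Y D_X Z - D_[X,Y] Z`. -/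
def curvature (g : Bundle.ContMDiffRiemannianMetric I ∞ E (fun p : M => TangentSpace I p))
    (X Y Z : Π p : M, TangentSpace I p) (p : M) : TangentSpace I p :=
  leviCivita g X (leviCivita g Y Z) p - leviCivita g Y (leviCivita g X Z) p
    - leviCivita g (VectorField.mlieBracket I X Y) Z p

/-- The Ricci tensor `Ric(Y, Z)` at `p`, the trace of the endomorphism `X ↦ R(X, Y) Z` of the
tangent space at `p`, computed in a basis whose vectors are extended to local vector fields. -/
def ricci [FiniteDimensional ℝ E]
    (g : Bundle.ContMDiffRiemannianMetric I ∞ E (fun p : M => TangentSpace I p))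
    (Y Z : Π p : M, TangentSpace I p) (p : M) : ℝ :=
  ∑ i, (Module.finBasis ℝ E).coord i
    (curvature g
      (FiberBundle.extend E (E := fun q : M => TangentSpace I q) (x := p)
        (Module.finBasis ℝ E i)) Y Z p)

/-- The Ricci curvature function of a unit vector field `ξ`, normalized as the average of the
sectional curvatures of the planes containing `ξ`: `Ric(ξ, ξ) / (n - 1)`, where `n = dim M`. -/
def ricciFunction [FiniteDimensional ℝ E]
    (g : Bundle.ContMDiffRiemannianMetric I ∞ E (fun p : M => TangentSpace I p))
    (ξ : Π p : M, TangentSpace I p) (p : M) : ℝ :=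
  ricci g ξ ξ p / ((Module.finrank ℝ E : ℝ) - 1)

/-- `ξ` is a Killing field: `L_ξ g = 0`, that is
`ξ (g(X, Y)) = g([ξ, X], Y) + g(X, [ξ, Y])` for all vector fields `X` and `Y`. -/
def IsKilling (g : Bundle.ContMDiffRiemannianMetric I ∞ E (fun p : M => TangentSpace I p))
    (ξ : Π p : M, TangentSpace I p) : Prop :=
  ∀ (p : M) (X Y : Π q : M, TangentSpace I q),
    MDifferentiableAt I I.tangent (T% X) p → MDifferentiableAt I I.tangent (T% Y) p →
      mvfderiv I (fun q => g.inner q (X q) (Y q)) p (ξ p)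
        = g.inner p (VectorField.mlieBracket I ξ X p) (Y p)
          + g.inner p (X p) (VectorField.mlieBracket I ξ Y p)

/-- `j` is a smooth orthogonal complex structure on the plane field `ξ^⊥` (in dimension three:
the rotation by a right angle in `ξ^⊥`, for one of the orientations), extended by `j ξ = 0`. -/
structure IsTransverseComplexStructure
    (g : Bundle.ContMDiffRiemannianMetric I ∞ E (fun p : M => TangentSpace I p))
    (ξ : Π p : M, TangentSpace I p) (j : Π p : M, TangentSpace I p →L[ℝ] TangentSpace I p) :
    Prop where
  smooth : ∀ (V : Set M) (X : Π p : M, TangentSpace I p), IsOpen V →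
    ContMDiffOn I I.tangent ∞ (T% X) V →
      ContMDiffOn I I.tangent ∞ (T% (fun p => j p (X p))) V
  apply_xi : ∀ p, j p (ξ p) = 0
  mem_perp : ∀ p (v : TangentSpace I p), g.inner p (j p v) (ξ p) = 0
  sq : ∀ p (v : TangentSpace I p), g.inner p v (ξ p) = 0 → j p (j p v) = -v
  orthogonal : ∀ p (v w : TangentSpace I p), g.inner p v (ξ p) = 0 → g.inner p w (ξ p) = 0 →
    g.inner p (j p v) (j p w) = g.inner p v w

/-- The tensor `t² g + (1 / c) dt ⊗ dt` at the point `x = (p, t)` of `M × ℝ`. -/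
def coneMetric (g : Bundle.ContMDiffRiemannianMetric I ∞ E (fun p : M => TangentSpace I p))
    (c : ℝ) (x : M × ℝ) :
    TangentSpace (I.prod 𝓘(ℝ, ℝ)) x →L[ℝ] TangentSpace (I.prod 𝓘(ℝ, ℝ)) x →L[ℝ] ℝ :=
  let G : E →L[ℝ] E →L[ℝ] ℝ := g.inner x.1
  let B : (E × ℝ) →L[ℝ] (E × ℝ) →L[ℝ] ℝ :=
    x.2 ^ 2 • G.bilinearComp (ContinuousLinearMap.fst ℝ E ℝ) (ContinuousLinearMap.fst ℝ E ℝ)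
      + (1 / c) • (ContinuousLinearMap.mul ℝ ℝ).bilinearComp
          (ContinuousLinearMap.snd ℝ E ℝ) (ContinuousLinearMap.snd ℝ E ℝ)
  B

/-- The endomorphism `J` of the tangent space of `M × ℝ` at `x = (p, t)` with `J = j` on `ξ^⊥`,
`J ((1 / t) ξ) = √c ∂_t` and `J (∂_t) = - (1 / (t √c)) ξ`; on a tangent vector `(u, τ)` it is
`J (u, τ) = (j u - (τ / (t √c)) ξ, t √c g(ξ, u))`. -/
def coneJ (g : Bundle.ContMDiffRiemannianMetric I ∞ E (fun p : M => TangentSpace I p))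
    (ξ : Π p : M, TangentSpace I p) (c : ℝ)
    (j : Π p : M, TangentSpace I p →L[ℝ] TangentSpace I p) (x : M × ℝ) :
    TangentSpace (I.prod 𝓘(ℝ, ℝ)) x →L[ℝ] TangentSpace (I.prod 𝓘(ℝ, ℝ)) x :=
  let j' : E →L[ℝ] E := j x.1
  let ξ' : E := ξ x.1
  let θ : E →L[ℝ] ℝ := g.inner x.1 (ξ x.1)
  let A : (E × ℝ) →L[ℝ] (E × ℝ) :=
    (j'.comp (ContinuousLinearMap.fst ℝ E ℝ)
        - (1 / (x.2 * √c)) • (ContinuousLinearMap.snd ℝ E ℝ).smulRight ξ').prod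
      ((x.2 * √c) • θ.comp (ContinuousLinearMap.fst ℝ E ℝ))
  A

end Riemannian

section Kahler

variable {E : Type*} [NormedAddCommGroup E] [NormedSpace ℝ E]
  {H : Type*} [TopologicalSpace H] (I : ModelWithCorners ℝ E H)
  {N : Type*} [TopologicalSpace N] [ChartedSpace H N] [IsManifold I ∞ N]

/-- The Nijenhuis tensor `[JX, JY] - J[JX, Y] - J[X, JY] - [X, Y]`. -/
def nijenhuis (J : Π x : N, TangentSpace I x →L[ℝ] TangentSpace I x)
    (X Y : Π x : N, TangentSpace I x) (x : N) : TangentSpace I x :=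
  VectorField.mlieBracket I (fun y => J y (X y)) (fun y => J y (Y y)) x
    - J x (VectorField.mlieBracket I (fun y => J y (X y)) Y x)
    - J x (VectorField.mlieBracket I X (fun y => J y (Y y)) x)
    - VectorField.mlieBracket I X Y x

/-- The exterior derivative `dΩ(X, Y, Z)` of the 2-form `Ω(X, Y) = G(JX, Y)`. -/
def dFundamentalForm (G : Π x : N, TangentSpace I x →L[ℝ] TangentSpace I x →L[ℝ] ℝ)
    (J : Π x : N, TangentSpace I x →L[ℝ] TangentSpace I x)
    (X Y Z : Π x : N, TangentSpace I x) (x : N) : ℝ :=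
  mvfderiv I (fun y => G y (J y (Y y)) (Z y)) x (X x)
    - mvfderiv I (fun y => G y (J y (X y)) (Z y)) x (Y x)
    + mvfderiv I (fun y => G y (J y (X y)) (Y y)) x (Z x)
    - G x (J x (VectorField.mlieBracket I X Y x)) (Z x)
    + G x (J x (VectorField.mlieBracket I X Z x)) (Y x)
    - G x (J x (VectorField.mlieBracket I Y Z x)) (X x)

/-- `(G, J)` is a Kähler structure on the open subset `U` of the manifold `N`: `G` is a smooth
Riemannian metric on `U`, `J` is a smooth integrable almost complex structure on `U` for which
`G` is hermitian, and the fundamental form `Ω(X, Y) = G(JX, Y)` is closed on `U`. Tensor fields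
are smooth if they are smooth on smooth vector fields defined on open subsets. -/
structure IsKahlerOn (G : Π x : N, TangentSpace I x →L[ℝ] TangentSpace I x →L[ℝ] ℝ)
    (J : Π x : N, TangentSpace I x →L[ℝ] TangentSpace I x) (U : Set N) : Prop where
  isOpen : IsOpen U
  metric_symm : ∀ x ∈ U, ∀ v w : TangentSpace I x, G x v w = G x w v
  metric_pos : ∀ x ∈ U, ∀ v : TangentSpace I x, v ≠ 0 → 0 < G x v v
  metric_smooth : ∀ (V : Set N) (X Y : Π x : N, TangentSpace I x), IsOpen V → V ⊆ U →
    ContMDiffOn I I.tangent ∞ (T% X) V → ContMDiffOn I I.tangent ∞ (T% Y) V →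
      ContMDiffOn I 𝓘(ℝ, ℝ) ∞ (fun x => G x (X x) (Y x)) V
  J_sq : ∀ x ∈ U, ∀ v : TangentSpace I x, J x (J x v) = -v
  J_smooth : ∀ (V : Set N) (X : Π x : N, TangentSpace I x), IsOpen V → V ⊆ U →
    ContMDiffOn I I.tangent ∞ (T% X) V →
      ContMDiffOn I I.tangent ∞ (T% (fun x => J x (X x))) V
  hermitian : ∀ x ∈ U, ∀ v w : TangentSpace I x, G x (J x v) (J x w) = G x v w
  integrable : ∀ (V : Set N) (X Y : Π x : N, TangentSpace I x), IsOpen V → V ⊆ U →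
    ContMDiffOn I I.tangent ∞ (T% X) V → ContMDiffOn I I.tangent ∞ (T% Y) V →
      ∀ x ∈ V, nijenhuis I J X Y x = 0
  closed : ∀ (V : Set N) (X Y Z : Π x : N, TangentSpace I x), IsOpen V → V ⊆ U →
    ContMDiffOn I I.tangent ∞ (T% X) V → ContMDiffOn I I.tangent ∞ (T% Y) V →
      ContMDiffOn I I.tangent ∞ (T% Z) V →
        ∀ x ∈ V, dFundamentalForm I G J X Y Z x = 0

end Kahler

end SasakiCone

end

/-!
Since `ξ` is a unit Killing field on a 3-manifold, `D_X ξ = α j X`, where `j` is a rotation by a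
right angle in `ξ^⊥` and `α` is a function. The flow of `ξ` preserves `Dξ`, which makes the
curvature along `ξ` the square of `Dξ` and gives `Ric(ξ) = α²`. As `Ric(ξ)` is positive, `α` has no
zero, and choosing its sign orients `ξ^⊥` and makes `j` global.

Where `Ric(ξ) = c`, the exterior derivative of `ξ♭` is `± 2 √c` times the area form of `ξ^⊥`.
Therefore the fundamental form of the cone is the differential of `-t² ξ♭ / (2 √c)`. Integrability
only has to be checked in a local frame `ξ / t, e₁ / t, e₂ / t, √c ∂_t` with `j e₁ = e₂`, on which
`J` has constant coefficients. The symmetries of the Nijenhuis tensor under `J` leave the single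
component `N(ξ / t, e₁ / t)`, and it vanishes because `[ξ, e₁]` and `[ξ, e₂]` are the derivatives of
a rotating frame of `ξ^⊥`.
-/

namespace SasakiCone

open VectorField Set

section LieBracket

variable {E : Type*} [NormedAddCommGroup E] [NormedSpace ℝ E]
  {H : Type*} [TopologicalSpace H] {I : ModelWithCorners ℝ E H}
  {M : Type*} [TopologicalSpace M] [ChartedSpace H M]

theorem mvfderiv_congr_of_eventuallyEq {f h : M → ℝ} {p : M} (hfh : f =ᶠ[𝓝 p] h) :
    mvfderiv I f p = mvfderiv I h p := by
  ext v
  simp only [mvfderiv, ContinuousLinearMap.comp_apply]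
  rw [hfh.mfderiv_eq]
  rfl

theorem mvfderiv_eq_zero_of_eventually_eq_const {f : M → ℝ} {a : ℝ} {p : M}
    (hf : ∀ᶠ q in 𝓝 p, f q = a) : mvfderiv I f p = 0 := by
  rw [mvfderiv_congr_of_eventuallyEq (h := fun _ => a) hf, mvfderiv_const]

theorem mdifferentiableAt_of_contMDiffOn {E' : Type*} [NormedAddCommGroup E'] [NormedSpace ℝ E']
    {H' : Type*} [TopologicalSpace H'] {I' : ModelWithCorners ℝ E' H'}
    {M' : Type*} [TopologicalSpace M'] [ChartedSpace H' M'] {U : Set M} (hU : IsOpen U)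
    {f : M → M'} (hf : ContMDiffOn I I' ∞ f U) {p : M} (hp : p ∈ U) :
    MDifferentiableAt I I' f p :=
  (hf.contMDiffAt (hU.mem_nhds hp)).mdifferentiableAt (by simp)

variable [IsManifold I ∞ M]

theorem eq_of_forall_mvfderiv_eq {p : M} {v w : TangentSpace I p}
    (h : ∀ (f : M → ℝ) (U : Set M), IsOpen U → p ∈ U → CMDiff[U] ∞ f →
      mvfderiv I f p v = mvfderiv I f p w) : v = w := by
  have hinv := isInvertible_mfderiv_extChartAt (I := I) (mem_extChartAt_source (I := I) p)
  refine hinv.injective ((SeparatingDual.eq_iff_forall_dual_eq (R := ℝ) (V := E)).mpr fun l => ?_)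
  have hsmooth : CMDiff[(chartAt H p).source] ∞ (fun q => l (extChartAt I p q)) :=
    l.contMDiff.comp_contMDiffOn contMDiffOn_extChartAt
  have hchain (u : TangentSpace I p) : mvfderiv I (fun q => l (extChartAt I p q)) p u
      = l (mfderiv I 𝓘(ℝ, E) (extChartAt I p) p u) := by
    have hl : mfderiv 𝓘(ℝ, E) 𝓘(ℝ, ℝ) l (extChartAt I p p) = l := by
      rw [mfderiv_eq_fderiv]
      exact l.fderiv
    refine (mvfderiv_comp_apply (I := 𝓘(ℝ, E)) (g := l) p l.differentiableAt.mdifferentiableAt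
      (mdifferentiableAt_extChartAt (I := I) (mem_chart_source H p)) u).trans ?_
    exact congrArg (fun m : E →L[ℝ] ℝ => m (mfderiv I 𝓘(ℝ, E) (extChartAt I p) p u)) hl
  have hl := h _ _ (chartAt H p).open_source (mem_chart_source H p) hsmooth
  rwa [hchain, hchain] at hl

theorem contMDiffOn_mvfderiv_apply {U : Set M} (hU : IsOpen U) {h : M → ℝ}
    (hh : CMDiff[U] ∞ h) {X : Π p : M, TangentSpace I p} (hX : CMDiff[U] ∞ (T% X)) :
    CMDiff[U] ∞ (fun q => mvfderiv I h q (X q)) := by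
  have hTh := (hh.contMDiffOn_tangentMapWithin (m := ∞) (by simp) hU.uniqueMDiffOn).comp hX
    (fun q hq => hq)
  refine ((contMDiff_snd_tangentBundle_modelSpace ℝ 𝓘(ℝ, ℝ) (n := ∞)).comp_contMDiffOn hTh).congr
    fun q hq => ?_
  change mfderiv I 𝓘(ℝ, ℝ) h q (X q) = mfderivWithin I 𝓘(ℝ, ℝ) h U q (X q)
  rw [mfderivWithin_of_isOpen hU hq]

variable [CompleteSpace E]

theorem contMDiffOn_mlieBracket {U : Set M} (hU : IsOpen U) {X Y : Π p : M, TangentSpace I p}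
    (hX : CMDiff[U] ∞ (T% X)) (hY : CMDiff[U] ∞ (T% Y)) :
    CMDiff[U] ∞ (T% (mlieBracket I X Y)) := by
  have : IsManifold I (minSmoothness ℝ 2) M := by
    rw [minSmoothness_of_isRCLikeNormedField]
    infer_instance
  have : IsManifold I (((⊤ : ℕ∞) : WithTop ℕ∞) + 1) M := by simpa
  exact fun p hp => (ContMDiffAt.mlieBracket_vectorField (m := ⊤) (n := ⊤)
    (hX.contMDiffAt (hU.mem_nhds hp)) (hY.contMDiffAt (hU.mem_nhds hp))
    (by simp)).contMDiffWithinAt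

theorem mlieBracket_jacobi {U : Set M} (hU : IsOpen U) {X Y Z : Π p : M, TangentSpace I p}
    (hX : CMDiff[U] ∞ (T% X)) (hY : CMDiff[U] ∞ (T% Y)) (hZ : CMDiff[U] ∞ (T% Z))
    {p : M} (hp : p ∈ U) :
    mlieBracket I X (mlieBracket I Y Z) p =
      mlieBracket I (mlieBracket I X Y) Z p + mlieBracket I Y (mlieBracket I X Z) p := by
  have : IsManifold I (minSmoothness ℝ 3) M := by
    rw [minSmoothness_of_isRCLikeNormedField]
    infer_instance
  have hle : minSmoothness ℝ 2 ≤ (∞ : WithTop ℕ∞) := by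
    rw [minSmoothness_of_isRCLikeNormedField]
    exact ENat.LEInfty.out
  exact leibniz_identity_mlieBracket_apply ((hX.contMDiffAt (hU.mem_nhds hp)).of_le hle)
    ((hY.contMDiffAt (hU.mem_nhds hp)).of_le hle) ((hZ.contMDiffAt (hU.mem_nhds hp)).of_le hle)

theorem mlieBracket_mlieBracket_smul {U : Set M} (hU : IsOpen U) {h : M → ℝ}
    (hh : CMDiff[U] ∞ h) {X Y Z : Π p : M, TangentSpace I p}
    (hY : CMDiff[U] ∞ (T% Y)) (hZ : CMDiff[U] ∞ (T% Z))
    {p : M} (hp : p ∈ U) :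
    mlieBracket I X (mlieBracket I Y (h • Z)) p
      = mvfderiv I (fun q => mvfderiv I h q (Y q)) p (X p) • Z p
        + mvfderiv I h p (Y p) • mlieBracket I X Z p
        + (mvfderiv I h p (X p) • mlieBracket I Y Z p
          + h p • mlieBracket I X (mlieBracket I Y Z) p) := by
  have hd {q : M} (hq : q ∈ U) : MDiffAt h q := mdifferentiableAt_of_contMDiffOn hU hh hq
  have hZd {q : M} (hq : q ∈ U) : MDiffAt (T% Z) q := mdifferentiableAt_of_contMDiffOn hU hZ hq
  have hYh := contMDiffOn_mvfderiv_apply hU hh hY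
  have hYZ := contMDiffOn_mlieBracket hU hY hZ
  have hleibniz : mlieBracket I Y (h • Z) =ᶠ[𝓝 p]
      (fun q => mvfderiv I h q (Y q)) • Z + h • mlieBracket I Y Z := by
    filter_upwards [hU.mem_nhds hp] with q hq
    exact mlieBracket_smul_right (hd hq) (hZd hq)
  rw [Filter.EventuallyEq.mlieBracket_vectorField_eq (Filter.EventuallyEq.refl (𝓝 p) X) hleibniz,
    mlieBracket_add_right (mdifferentiableAt_of_contMDiffOn hU (hYh.smul_section hZ) hp)
      (mdifferentiableAt_of_contMDiffOn hU (hh.smul_section hYZ) hp),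
    mlieBracket_smul_right (mdifferentiableAt_of_contMDiffOn hU hYh hp) (hZd hp),
    mlieBracket_smul_right (hd hp) (mdifferentiableAt_of_contMDiffOn hU hYZ hp)]

-- The coefficient of `Z` in the Jacobi identity for `X`, `Y`, `h • Z` is the claim.
theorem mvfderiv_mlieBracket_of_exists_ne_zero {U : Set M} (hU : IsOpen U) {h : M → ℝ}
    (hh : CMDiff[U] ∞ h) {X Y Z : Π p : M, TangentSpace I p}
    (hX : CMDiff[U] ∞ (T% X)) (hY : CMDiff[U] ∞ (T% Y)) (hZ : CMDiff[U] ∞ (T% Z))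
    {p : M} (hp : p ∈ U) (hZp : Z p ≠ 0) :
    mvfderiv I h p (mlieBracket I X Y p)
      = mvfderiv I (fun q => mvfderiv I h q (Y q)) p (X p)
        - mvfderiv I (fun q => mvfderiv I h q (X q)) p (Y p) := by
  have hjacobi := mlieBracket_jacobi hU hX hY (hh.smul_section hZ) hp
  rw [mlieBracket_mlieBracket_smul hU hh hY hZ hp,
    mlieBracket_mlieBracket_smul hU hh hX hZ hp,
    mlieBracket_smul_right (mdifferentiableAt_of_contMDiffOn hU hh hp)
      (mdifferentiableAt_of_contMDiffOn hU hZ hp),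
    mlieBracket_jacobi hU hX hY hZ hp, ← sub_eq_zero] at hjacobi
  have hsmul : (mvfderiv I (fun q => mvfderiv I h q (Y q)) p (X p)
      - mvfderiv I (fun q => mvfderiv I h q (X q)) p (Y p)
      - mvfderiv I h p (mlieBracket I X Y p)) • Z p = 0 := by
    rw [← hjacobi]
    module
  exact (sub_eq_zero.mp ((smul_eq_zero.mp hsmul).resolve_right hZp)).symm

theorem mvfderiv_mlieBracket {U : Set M} (hU : IsOpen U) {h : M → ℝ} (hh : CMDiff[U] ∞ h)
    {X Y : Π p : M, TangentSpace I p} (hX : CMDiff[U] ∞ (T% X)) (hY : CMDiff[U] ∞ (T% Y))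
    {p : M} (hp : p ∈ U) :
    mvfderiv I h p (mlieBracket I X Y p)
      = mvfderiv I (fun q => mvfderiv I h q (Y q)) p (X p)
        - mvfderiv I (fun q => mvfderiv I h q (X q)) p (Y p) := by
  rcases subsingleton_or_nontrivial (TangentSpace I p) with htriv | hnontriv
  · rw [Subsingleton.elim (mlieBracket I X Y p) 0, Subsingleton.elim (X p) 0,
      Subsingleton.elim (Y p) 0]
    simp
  · obtain ⟨v, hv⟩ := exists_ne (0 : TangentSpace I p)
    obtain ⟨s, hs, hsmooth⟩ := FiberBundle.exists_contMDiffOn_extend (k := ∞) I E v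
    obtain ⟨V, hVs, hV, hpV⟩ := mem_nhds_iff.mp hs
    exact mvfderiv_mlieBracket_of_exists_ne_zero (hU.inter hV) (hh.mono inter_subset_left)
      (hX.mono inter_subset_left) (hY.mono inter_subset_left)
      ((hsmooth.mono hVs).mono inter_subset_right) ⟨hp, hpV⟩
      (by rwa [FiberBundle.extend_apply_self])

section Related

variable {E' : Type*} [NormedAddCommGroup E'] [NormedSpace ℝ E'] [CompleteSpace E']
  {H' : Type*} [TopologicalSpace H'] {I' : ModelWithCorners ℝ E' H'}
  {N : Type*} [TopologicalSpace N] [ChartedSpace H' N]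

omit [IsManifold I ∞ M] [CompleteSpace E] [CompleteSpace E'] in
theorem mvfderiv_comp_of_related {f : N → M} {h : M → ℝ} {y : N} (hf : MDiffAt f y)
    (hh : MDiffAt h (f y)) {X' : Π y : N, TangentSpace I' y} {X : Π p : M, TangentSpace I p}
    (hX : mfderiv I' I f y (X' y) = X (f y)) :
    mvfderiv I' (h ∘ f) y (X' y) = mvfderiv I h (f y) (X (f y)) := by
  rw [mvfderiv_comp_apply y hh hf, hX]

theorem mfderiv_mlieBracket_of_related [IsManifold I' ∞ N] {f : N → M} {W : Set N} {U : Set M}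
    (hW : IsOpen W) (hU : IsOpen U) (hf : CMDiff[W] ∞ f) (hWU : MapsTo f W U)
    {X' Y' : Π y : N, TangentSpace I' y} {X Y : Π p : M, TangentSpace I p}
    (hX' : CMDiff[W] ∞ (T% X')) (hY' : CMDiff[W] ∞ (T% Y'))
    (hX : CMDiff[U] ∞ (T% X)) (hY : CMDiff[U] ∞ (T% Y))
    (hXX' : ∀ y ∈ W, mfderiv I' I f y (X' y) = X (f y))
    (hYY' : ∀ y ∈ W, mfderiv I' I f y (Y' y) = Y (f y)) {y : N} (hy : y ∈ W) :
    mfderiv I' I f y (mlieBracket I' X' Y' y) = mlieBracket I X Y (f y) := by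
  refine eq_of_forall_mvfderiv_eq fun h U₀ hU₀ hyU₀ hh => ?_
  have hU' : IsOpen (U ∩ U₀) := hU.inter hU₀
  have hW' : IsOpen (W ∩ f ⁻¹' (U ∩ U₀)) := hf.continuousOn.isOpen_inter_preimage hW hU'
  have hyW' : y ∈ W ∩ f ⁻¹' (U ∩ U₀) := ⟨hy, hWU hy, hyU₀⟩
  replace hh : CMDiff[U ∩ U₀] ∞ h := hh.mono inter_subset_right
  replace hX : CMDiff[U ∩ U₀] ∞ (T% X) := hX.mono inter_subset_left
  replace hY : CMDiff[U ∩ U₀] ∞ (T% Y) := hY.mono inter_subset_left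
  have hfd {z : N} (hz : z ∈ W) : MDiffAt f z := mdifferentiableAt_of_contMDiffOn hW hf hz
  have hhf : CMDiff[W ∩ f ⁻¹' (U ∩ U₀)] ∞ (h ∘ f) :=
    hh.comp (hf.mono inter_subset_left) fun z hz => hz.2
  have hderiv {Z' : Π y : N, TangentSpace I' y} {Z : Π p : M, TangentSpace I p}
      (hZZ' : ∀ z ∈ W, mfderiv I' I f z (Z' z) = Z (f z)) :
      (fun z => mvfderiv I' (h ∘ f) z (Z' z)) =ᶠ[𝓝 y] (fun q => mvfderiv I h q (Z q)) ∘ f := by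
    filter_upwards [hW'.mem_nhds hyW'] with z hz
    exact mvfderiv_comp_of_related (hfd hz.1) (mdifferentiableAt_of_contMDiffOn hU' hh hz.2)
      (hZZ' z hz.1)
  have hderiv₂ {Z : Π p : M, TangentSpace I p} (hZ : CMDiff[U ∩ U₀] ∞ (T% Z)) :
      MDiffAt (fun q => mvfderiv I h q (Z q)) (f y) :=
    mdifferentiableAt_of_contMDiffOn hU' (contMDiffOn_mvfderiv_apply hU' hh hZ) hyW'.2
  rw [← mvfderiv_comp_apply y (mdifferentiableAt_of_contMDiffOn hU' hh hyW'.2) (hfd hy),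
    mvfderiv_mlieBracket hW' hhf (hX'.mono inter_subset_left) (hY'.mono inter_subset_left) hyW',
    mvfderiv_congr_of_eventuallyEq (hderiv hXX'), mvfderiv_congr_of_eventuallyEq (hderiv hYY'),
    mvfderiv_comp_of_related (hfd hy) (hderiv₂ hY) (hXX' y hy),
    mvfderiv_comp_of_related (hfd hy) (hderiv₂ hX) (hYY' y hy),
    mvfderiv_mlieBracket hU' hh hX hY hyW'.2]

end Related

section Frame

variable {ι : Type*} {x y : ι → M → ℝ} {F : ι → Π p : M, TangentSpace I p} {p : M}

theorem mlieBracket_sum_right (s : Finset ι) {X : Π p : M, TangentSpace I p}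
    (hx : ∀ i, MDiffAt (x i) p) (hF : ∀ i, MDiffAt (T% (F i)) p) :
    mlieBracket I X (fun q => ∑ i ∈ s, x i q • F i q) p
      = ∑ i ∈ s, (mvfderiv I (x i) p (X p) • F i p + x i p • mlieBracket I X (F i) p) := by
  classical
  induction s using Finset.induction_on with
  | empty =>
    simp only [Finset.sum_empty]
    exact congrFun (mlieBracket_zero_right (I := I) (W := X)) p
  | insert a s ha ih =>
    have hsum : (fun q => ∑ i ∈ insert a s, x i q • F i q)
        = x a • F a + fun q => ∑ i ∈ s, x i q • F i q := by
      funext q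
      simp [Finset.sum_insert ha]
    have hd : MDiffAt (T% (fun q => ∑ i ∈ s, x i q • F i q)) p :=
      MDifferentiableAt.sum_section (t := fun i => x i • F i)
        fun i _ => (hx i).smul_section (hF i)
    rw [hsum, mlieBracket_add_right ((hx a).smul_section (hF a)) hd, ih,
      mlieBracket_smul_right (hx a) (hF a), Finset.sum_insert ha]

theorem mlieBracket_sum_sum [Fintype ι] (hx : ∀ i, MDiffAt (x i) p) (hy : ∀ i, MDiffAt (y i) p)
    (hF : ∀ i, MDiffAt (T% (F i)) p) :
    mlieBracket I (fun q => ∑ i, x i q • F i q) (fun q => ∑ i, y i q • F i q) p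
      = ∑ k, (mvfderiv I (y k) p (∑ i, x i p • F i p)
          - mvfderiv I (x k) p (∑ i, y i p • F i p)) • F k p
        + ∑ i, ∑ j, (x i p * y j p) • mlieBracket I (F i) (F j) p := by
  have hleft (j : ι) : mlieBracket I (fun q => ∑ i, x i q • F i q) (F j) p
      = ∑ i, (-mvfderiv I (x i) p (F j p) • F i p + x i p • mlieBracket I (F i) (F j) p) := by
    rw [mlieBracket_swap_apply, mlieBracket_sum_right _ hx hF, ← Finset.sum_neg_distrib]
    refine Finset.sum_congr rfl fun i _ => ?_
    rw [mlieBracket_swap_apply (V := F i)]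
    module
  rw [mlieBracket_sum_right _ hy hF]
  simp only [hleft, Finset.sum_add_distrib, sub_smul, Finset.sum_sub_distrib, smul_add, mul_smul,
    Finset.smul_sum, map_sum, map_smul, smul_eq_mul, Finset.sum_smul]
  rw [Finset.sum_comm (f := fun j i => y j p • -(mvfderiv I (x i) p) (F j p) • F i p),
    Finset.sum_comm (f := fun j i => y j p • x i p • mlieBracket I (F i) (F j) p)]
  simp only [smul_comm (y _ p) (x _ p), neg_smul, smul_neg, Finset.sum_neg_distrib]
  abel

end Frame

end LieBracket

section OrthonormalFrame

variable {E : Type*} [NormedAddCommGroup E] [NormedSpace ℝ E]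
  {H : Type*} [TopologicalSpace H] {I : ModelWithCorners ℝ E H}
  {M : Type*} [TopologicalSpace M] [ChartedSpace H M] [IsManifold I ∞ M]

/-- `e` is a smooth family of vector fields on the open set `U` that is orthonormal for the field
of bilinear forms `G`. Nothing is required of `G` itself, so that the notion applies both to a
Riemannian metric and to a tensor such as the cone metric that is a metric only on an open set. -/
structure IsOrthonormalOn (G : Π p : M, TangentSpace I p →L[ℝ] TangentSpace I p →L[ℝ] ℝ) {n : ℕ}
    (e : Fin n → Π p : M, TangentSpace I p) (U : Set M) : Prop where
  isOpen : IsOpen U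
  smooth : ∀ i, ContMDiffOn I I.tangent ∞ (T% (e i)) U
  inner_eq : ∀ p ∈ U, ∀ i j, G p (e i p) (e j p) = if i = j then 1 else 0

namespace IsOrthonormalOn

variable {G : Π p : M, TangentSpace I p →L[ℝ] TangentSpace I p →L[ℝ] ℝ} {n : ℕ}
  {e : Fin n → Π p : M, TangentSpace I p} {U : Set M}

theorem mono (h : IsOrthonormalOn G e U) {V : Set M} (hV : IsOpen V) (hVU : V ⊆ U) :
    IsOrthonormalOn G e V :=
  ⟨hV, fun i => (h.smooth i).mono hVU, fun p hp => h.inner_eq p (hVU hp)⟩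

theorem mdifferentiableAt (h : IsOrthonormalOn G e U) {p : M} (hp : p ∈ U) (i : Fin n) :
    MDiffAt (T% (e i)) p :=
  mdifferentiableAt_of_contMDiffOn h.isOpen (h.smooth i) hp

theorem comp_perm (h : IsOrthonormalOn G e U) (σ : Equiv.Perm (Fin n)) :
    IsOrthonormalOn G (e ∘ σ) U where
  isOpen := h.isOpen
  smooth i := h.smooth (σ i)
  inner_eq p hp i j := by
    rw [Function.comp_apply, Function.comp_apply, h.inner_eq p hp]
    exact if_congr σ.injective.eq_iff rfl rfl

theorem snoc (h : IsOrthonormalOn G e U) {X : Π p : M, TangentSpace I p} (hX : CMDiff[U] ∞ (T% X))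
    (hunit : ∀ p ∈ U, G p (X p) (X p) = 1) (hleft : ∀ p ∈ U, ∀ i, G p (X p) (e i p) = 0)
    (hright : ∀ p ∈ U, ∀ i, G p (e i p) (X p) = 0) :
    IsOrthonormalOn G (Fin.snoc (α := fun _ => Π p : M, TangentSpace I p) e X) U where
  isOpen := h.isOpen
  smooth i := by
    induction i using Fin.lastCases with
    | last => simpa only [Fin.snoc_last] using hX
    | cast i => simpa only [Fin.snoc_castSucc] using h.smooth i
  inner_eq p hp i j := by
    induction i using Fin.lastCases with
    | last =>
      induction j using Fin.lastCases with
      | last => rw [Fin.snoc_last, hunit p hp, if_pos rfl]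
      | cast j =>
        rw [Fin.snoc_last, Fin.snoc_castSucc, hleft p hp, if_neg (Fin.castSucc_lt_last j).ne']
    | cast i =>
      induction j using Fin.lastCases with
      | last =>
        rw [Fin.snoc_last, Fin.snoc_castSucc, hright p hp, if_neg (Fin.castSucc_lt_last i).ne]
      | cast j => simp only [Fin.snoc_castSucc, h.inner_eq p hp, Fin.castSucc_inj]

theorem inner_sum_left (h : IsOrthonormalOn G e U) {p : M} (hp : p ∈ U) (a : Fin n → ℝ)
    (j : Fin n) : G p (∑ i, a i • e i p) (e j p) = a j := by
  simp [map_sum, h.inner_eq p hp]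

theorem linearIndependent (h : IsOrthonormalOn G e U) {p : M} (hp : p ∈ U) :
    LinearIndependent ℝ (fun i => e i p) := by
  rw [Fintype.linearIndependent_iff]
  intro a ha i
  rw [← h.inner_sum_left hp a i, ha]
  simp

variable [FiniteDimensional ℝ E]

theorem expand (h : IsOrthonormalOn G e U) (hE : Module.finrank ℝ E = n) {p : M} (hp : p ∈ U)
    (v : TangentSpace I p) : v = ∑ i, G p v (e i p) • e i p := by
  have : FiniteDimensional ℝ (TangentSpace I p) := inferInstanceAs (FiniteDimensional ℝ E)
  have hspan : Submodule.span ℝ (range fun i => e i p) = ⊤ :=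
    (h.linearIndependent hp).span_eq_top_of_card_eq_finrank' ((Fintype.card_fin n).trans hE.symm)
  have hv : v ∈ Submodule.span ℝ (range fun i => e i p) := hspan ▸ Submodule.mem_top
  obtain ⟨a, rfl⟩ := (Submodule.mem_span_range_iff_exists_fun ℝ).mp hv
  simp_rw [h.inner_sum_left hp]

theorem inner_eq_sum (h : IsOrthonormalOn G e U) (hE : Module.finrank ℝ E = n) {p : M}
    (hp : p ∈ U) (v w : TangentSpace I p) :
    G p v w = ∑ i, G p v (e i p) * G p w (e i p) :=
  (congrArg (G p v) (h.expand hE hp w)).trans (by simp [map_sum, mul_comm])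

theorem inner_comm (h : IsOrthonormalOn G e U) (hE : Module.finrank ℝ E = n) {p : M}
    (hp : p ∈ U) (v w : TangentSpace I p) : G p v w = G p w v := by
  rw [h.inner_eq_sum hE hp, h.inner_eq_sum hE hp w]
  simp only [mul_comm]

theorem inner_self_pos (h : IsOrthonormalOn G e U) (hE : Module.finrank ℝ E = n) {p : M}
    (hp : p ∈ U) {v : TangentSpace I p} (hv : v ≠ 0) : 0 < G p v v := by
  rw [h.inner_eq_sum hE hp]
  refine lt_of_le_of_ne (Finset.sum_nonneg fun i _ => mul_self_nonneg _) fun hsum => hv ?_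
  have hcoord := (Finset.sum_eq_zero_iff_of_nonneg fun i _ => mul_self_nonneg _).mp hsum.symm
  rw [h.expand hE hp v]
  exact Finset.sum_eq_zero fun i hi => by rw [mul_self_eq_zero.mp (hcoord i hi), zero_smul]

theorem eventuallyEq_sum (h : IsOrthonormalOn G e U) (hE : Module.finrank ℝ E = n) {p : M}
    (hp : p ∈ U) (X : Π p : M, TangentSpace I p) :
    X =ᶠ[𝓝 p] fun q => ∑ i, G q (X q) (e i q) • e i q := by
  filter_upwards [h.isOpen.mem_nhds hp] with q hq using h.expand hE hq (X q)

theorem inner_mlieBracket (h : IsOrthonormalOn G e U)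
    (hE : Module.finrank ℝ E = n) {X Y : Π p : M, TangentSpace I p} {p : M} (hp : p ∈ U)
    (hX : ∀ i, MDiffAt (fun q => G q (X q) (e i q)) p)
    (hY : ∀ i, MDiffAt (fun q => G q (Y q) (e i q)) p) (k : Fin n) :
    G p (mlieBracket I X Y p) (e k p)
      = mvfderiv I (fun q => G q (Y q) (e k q)) p (X p)
        - mvfderiv I (fun q => G q (X q) (e k q)) p (Y p)
        + ∑ i, ∑ j, G p (X p) (e i p) * G p (Y p) (e j p)
          * G p (mlieBracket I (e i) (e j) p) (e k p) := by
  have : CompleteSpace E := FiniteDimensional.complete ℝ E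
  have hsum := ((h.eventuallyEq_sum hE hp X).mlieBracket_vectorField_eq
    (h.eventuallyEq_sum hE hp Y)).trans (mlieBracket_sum_sum hX hY (h.mdifferentiableAt hp))
  rw [hsum, ← h.expand hE hp (X p), ← h.expand hE hp (Y p), map_add, add_apply,
    h.inner_sum_left hp]
  simp [map_sum]

end IsOrthonormalOn

end OrthonormalFrame

section GramSchmidt

variable {E : Type*} [NormedAddCommGroup E] [NormedSpace ℝ E]
  {H : Type*} [TopologicalSpace H] {I : ModelWithCorners ℝ E H}
  {M : Type*} [TopologicalSpace M] [ChartedSpace H M]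

theorem contMDiffOn_inv_sqrt {f : M → ℝ} {U : Set M} (hf : CMDiff[U] ∞ f)
    (hpos : ∀ p ∈ U, 0 < f p) : CMDiff[U] ∞ (fun p => (√(f p))⁻¹) := by
  intro p hp
  have hsqrt : ContDiffAt ℝ ∞ (fun r : ℝ => (√r)⁻¹) (f p) :=
    (Real.contDiffAt_sqrt (hpos p hp).ne').inv (Real.sqrt_ne_zero'.mpr (hpos p hp))
  exact ContMDiffAt.comp_contMDiffWithinAt p (g := fun r : ℝ => (√r)⁻¹) hsqrt.contMDiffAt (hf p hp)

variable [IsManifold I ∞ M]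
  {g : Bundle.ContMDiffRiemannianMetric I ∞ E (fun p : M => TangentSpace I p)}

theorem contMDiffOn_inner {E' : Type*} [NormedAddCommGroup E'] [NormedSpace ℝ E']
    {H' : Type*} [TopologicalSpace H'] {I' : ModelWithCorners ℝ E' H'}
    {N : Type*} [TopologicalSpace N] [ChartedSpace H' N] {b : N → M} {U : Set N}
    {X Y : Π x : N, TangentSpace I (b x)}
    (hX : ContMDiffOn I' I.tangent ∞ (fun x => (⟨b x, X x⟩ : TangentBundle I M)) U)
    (hY : ContMDiffOn I' I.tangent ∞ (fun x => (⟨b x, Y x⟩ : TangentBundle I M)) U) :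
    ContMDiffOn I' 𝓘(ℝ, ℝ) ∞ (fun x => g.inner (b x) (X x) (Y x)) U := by
  intro x hx
  have hb : ContMDiffWithinAt I' I ∞ b U x :=
    (Bundle.contMDiffWithinAt_totalSpace.mp (hX x hx)).1
  have h : ContMDiffWithinAt I' (I.prod 𝓘(ℝ)) ∞
      (fun m => Bundle.TotalSpace.mk' ℝ (E := Bundle.Trivial M ℝ) (b m)
        (g.inner (b m) (X m) (Y m))) U x :=
    ContMDiffWithinAt.clm_bundle_apply₂ (F₁ := E) (F₂ := E)
      (g.contMDiff.contMDiffAt.comp_contMDiffWithinAt x hb) (hX x hx) (hY x hx)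
  exact (Bundle.contMDiffWithinAt_totalSpace.mp h).2

theorem mdifferentiableAt_inner {X Y : Π p : M, TangentSpace I p} {p : M}
    (hX : MDiffAt (T% X) p) (hY : MDiffAt (T% Y) p) :
    MDiffAt (fun q => g.inner q (X q) (Y q)) p := by
  have h : MDifferentiableAt I (I.prod 𝓘(ℝ))
      (fun m => Bundle.TotalSpace.mk' ℝ (E := Bundle.Trivial M ℝ) m
        (g.inner m (X m) (Y m))) p :=
    MDifferentiableAt.clm_bundle_apply₂ (F₁ := E) (F₂ := E)
      (g.contMDiff.mdifferentiableAt (by simp)) hX hY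
  exact ((mdifferentiableAt_totalSpace _ _).mp h).2

namespace IsOrthonormalOn

variable {n : ℕ} {e : Fin n → Π p : M, TangentSpace I p} {U : Set M}

theorem snoc_normalize (h : IsOrthonormalOn g.inner e U) {X : Π p : M, TangentSpace I p}
    (hX : CMDiff[U] ∞ (T% X)) (hne : ∀ p ∈ U, X p ≠ 0)
    (horth : ∀ p ∈ U, ∀ i, g.inner p (X p) (e i p) = 0) :
    IsOrthonormalOn g.inner (Fin.snoc (α := fun _ => Π p : M, TangentSpace I p) e
      ((fun p => (√(g.inner p (X p) (X p)))⁻¹) • X)) U := by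
  have hpos : ∀ p ∈ U, 0 < g.inner p (X p) (X p) := fun p hp => g.pos p _ (hne p hp)
  refine h.snoc ((contMDiffOn_inv_sqrt (contMDiffOn_inner hX hX) hpos).smul_section hX)
    (fun p hp => ?_) (fun p hp i => ?_) (fun p hp i => ?_)
  · have hsqrt : √(g.inner p (X p) (X p)) ≠ 0 := Real.sqrt_ne_zero'.mpr (hpos p hp)
    simp only [Pi.smul_apply', map_smul, smul_apply, smul_eq_mul]
    field_simp
    exact (Real.sq_sqrt (hpos p hp).le).symm
  · simp [horth p hp]
  · simp [g.symm p (e i p), horth p hp]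

theorem exists_smooth_orthogonal_ne_zero [FiniteDimensional ℝ E]
    (h : IsOrthonormalOn g.inner e U) (hn : n < Module.finrank ℝ E) {p : M} (hp : p ∈ U) :
    ∃ (X : Π p : M, TangentSpace I p) (V : Set M), IsOpen V ∧ p ∈ V ∧ V ⊆ U ∧
      CMDiff[V] ∞ (T% X) ∧ ∀ q ∈ V, X q ≠ 0 ∧ ∀ i, g.inner q (X q) (e i q) = 0 := by
  have : FiniteDimensional ℝ (TangentSpace I p) := inferInstanceAs (FiniteDimensional ℝ E)
  obtain ⟨v, hv⟩ := exists_linearIndependent_snoc_of_lt_finrank (h.linearIndependent hp) hn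
  replace hv := (linearIndependent_finSnoc.mp hv).2
  obtain ⟨s, hs, hsmooth⟩ := FiberBundle.exists_contMDiffOn_extend (k := ∞) I E v
  obtain ⟨V, hVsU, hV, hpV⟩ := mem_nhds_iff.mp (Filter.inter_mem hs (h.isOpen.mem_nhds hp))
  obtain ⟨hVs, hVU⟩ := subset_inter_iff.mp hVsU
  set W : Π q : M, TangentSpace I q := FiberBundle.extend E v with hW
  set X : Π q : M, TangentSpace I q := W - fun q => ∑ i, g.inner q (W q) (e i q) • e i q with hX
  have hWsmooth : CMDiff[V] ∞ (T% W) := hsmooth.mono hVs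
  have hesmooth (i : Fin n) : CMDiff[V] ∞ (T% (e i)) := (h.smooth i).mono hVU
  have hXsmooth : CMDiff[V] ∞ (T% X) :=
    hWsmooth.sub_section (ContMDiffOn.sum_section fun i _ =>
      (contMDiffOn_inner hWsmooth (hesmooth i)).smul_section (hesmooth i))
  have hXp : X p ≠ 0 := by
    intro hzero
    have hvsum : v = ∑ i, g.inner p (W p) (e i p) • e i p := by
      simpa [hX, sub_eq_zero, hW] using hzero
    exact hv (hvsum ▸ Submodule.sum_mem _ fun i _ =>
      Submodule.smul_mem _ _ (Submodule.subset_span ⟨i, rfl⟩))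
  refine ⟨X, V ∩ (fun q => g.inner q (X q) (X q)) ⁻¹' Ioi 0,
    (contMDiffOn_inner hXsmooth hXsmooth).continuousOn.isOpen_inter_preimage hV isOpen_Ioi,
    ⟨hpV, g.pos p _ hXp⟩, inter_subset_left.trans hVU, hXsmooth.mono inter_subset_left,
    fun q hq => ⟨fun hzero => ?_, fun i => ?_⟩⟩
  · have hpos : 0 < g.inner q (X q) (X q) := hq.2
    simp [hzero] at hpos
  · simp only [hX, Pi.sub_apply, map_sub, sub_apply]
    rw [h.inner_sum_left (hVU hq.1), sub_self]

theorem exists_snoc [FiniteDimensional ℝ E] (h : IsOrthonormalOn g.inner e U)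
    (hn : n < Module.finrank ℝ E) {p : M} (hp : p ∈ U) :
    ∃ (X : Π p : M, TangentSpace I p) (V : Set M), p ∈ V ∧
      IsOrthonormalOn g.inner (Fin.snoc (α := fun _ => Π p : M, TangentSpace I p) e X) V := by
  obtain ⟨X, V, hV, hpV, hVU, hX, hXV⟩ := h.exists_smooth_orthogonal_ne_zero hn hp
  exact ⟨_, V, hpV, (h.mono hV hVU).snoc_normalize hX (fun q hq => (hXV q hq).1)
    fun q hq => (hXV q hq).2⟩

end IsOrthonormalOn

theorem exists_orthonormal_frame_zero_eq [FiniteDimensional ℝ E] (hE : Module.finrank ℝ E = 3)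
    {ξ : Π p : M, TangentSpace I p} (hξ : CMDiff ∞ (T% ξ))
    (hunit : ∀ p, g.inner p (ξ p) (ξ p) = 1) (p : M) :
    ∃ (e : Fin 3 → Π p : M, TangentSpace I p) (U : Set M), p ∈ U ∧
      IsOrthonormalOn g.inner e U ∧ e 0 = ξ := by
  have hξ₁ : IsOrthonormalOn g.inner (fun _ : Fin 1 => ξ) univ :=
    ⟨isOpen_univ, fun _ => hξ.contMDiffOn, fun q _ i j => by
      rw [if_pos (Subsingleton.elim i j), hunit]⟩
  obtain ⟨X, V, hpV, hξX⟩ := hξ₁.exists_snoc (by omega) (mem_univ p)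
  obtain ⟨Y, V', hpV', hξXY⟩ := hξX.exists_snoc (by omega) hpV
  exact ⟨_, V', hpV', hξXY, rfl⟩

end GramSchmidt

section LeviCivita

variable {E : Type*} [NormedAddCommGroup E] [NormedSpace ℝ E]
  {H : Type*} [TopologicalSpace H] {I : ModelWithCorners ℝ E H}
  {M : Type*} [TopologicalSpace M] [ChartedSpace H M] [IsManifold I ∞ M]
  {g : Bundle.ContMDiffRiemannianMetric I ∞ E (fun p : M => TangentSpace I p)}

theorem eq_of_forall_inner_eq {p : M} {v w : TangentSpace I p}
    (h : ∀ u : TangentSpace I p, g.inner p v u = g.inner p w u) : v = w := by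
  by_contra hne
  have hpos := g.pos p (v - w) (sub_ne_zero.mpr hne)
  rw [map_sub (g.inner p) v w, sub_apply, h, sub_self] at hpos
  exact hpos.false

theorem leviCivita_eq {X Y : Π p : M, TangentSpace I p} {p : M} {w : TangentSpace I p}
    (hw : ∀ Z : Π q : M, TangentSpace I q, MDiffAt (T% Z) p →
      2 * g.inner p w (Z p) = koszul g X Y Z p) : leviCivita g X Y p = w := by
  have hspec := Classical.epsilon_spec (p := fun w : TangentSpace I p =>
    ∀ Z : Π q : M, TangentSpace I q, MDiffAt (T% Z) p →
      2 * g.inner p w (Z p) = koszul g X Y Z p) ⟨w, hw⟩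
  refine eq_of_forall_inner_eq (g := g) fun u => ?_
  have hd : MDiffAt (T% (FiberBundle.extend E u : Π q : M, TangentSpace I q)) p :=
    FiberBundle.mdifferentiableAt_extend I E u
  have hu := (hspec _ hd).trans (hw _ hd).symm
  rw [FiberBundle.extend_apply_self] at hu
  exact mul_left_cancel₀ two_ne_zero hu

theorem leviCivita_congr {X Y Y' : Π p : M, TangentSpace I p} {p : M} (hY : Y =ᶠ[𝓝 p] Y') :
    leviCivita g X Y p = leviCivita g X Y' p := by
  have hkoszul (Z : Π q : M, TangentSpace I q) : koszul g X Y Z p = koszul g X Y' Z p := by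
    have hYZ : (fun q => g.inner q (Y q) (Z q)) =ᶠ[𝓝 p] fun q => g.inner q (Y' q) (Z q) := by
      filter_upwards [hY] with q hq using by rw [hq]
    have hXY : (fun q => g.inner q (X q) (Y q)) =ᶠ[𝓝 p] fun q => g.inner q (X q) (Y' q) := by
      filter_upwards [hY] with q hq using by rw [hq]
    simp only [koszul]
    rw [mvfderiv_congr_of_eventuallyEq hYZ, mvfderiv_congr_of_eventuallyEq hXY,
      (Filter.EventuallyEq.refl (𝓝 p) X).mlieBracket_vectorField_eq hY,
      hY.mlieBracket_vectorField_eq (Filter.EventuallyEq.refl (𝓝 p) Z), hY.eq_of_nhds]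
  simp only [leviCivita, hkoszul]

theorem leviCivita_zero_right (X : Π p : M, TangentSpace I p) (p : M) :
    leviCivita g X (0 : Π p : M, TangentSpace I p) p = 0 := by
  refine leviCivita_eq fun Z _ => ?_
  simp only [koszul, mlieBracket_zero_right, mlieBracket_zero_left, Pi.zero_apply, map_zero,
    zero_apply, mvfderiv_const]
  norm_num

end LeviCivita

noncomputable section KillingFrame

variable {E : Type*} [NormedAddCommGroup E] [NormedSpace ℝ E]
  {H : Type*} [TopologicalSpace H] {I : ModelWithCorners ℝ E H}
  {M : Type*} [TopologicalSpace M] [ChartedSpace H M] [IsManifold I ∞ M]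
  {g : Bundle.ContMDiffRiemannianMetric I ∞ E (fun p : M => TangentSpace I p)}

/-- The twist of an orthonormal frame `e` in dimension three: half of the `e₀`-component of
`[e₂, e₁]`. If `e₀` is a Killing field, then `D e₀` is the twist times `frameRot g e`. -/
def frameTwist (g : Bundle.ContMDiffRiemannianMetric I ∞ E (fun p : M => TangentSpace I p))
    (e : Fin 3 → Π p : M, TangentSpace I p) (p : M) : ℝ :=
  -(1 / 2) * g.inner p (mlieBracket I (e 1) (e 2) p) (e 0 p)

/-- The `e₂`-component of `[e₀, e₁]` for an orthonormal frame `e` in dimension three: the angular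
velocity at which the flow of a Killing field `e₀` turns the plane spanned by `e₁` and `e₂`. -/
def frameSpin (g : Bundle.ContMDiffRiemannianMetric I ∞ E (fun p : M => TangentSpace I p))
    (e : Fin 3 → Π p : M, TangentSpace I p) (p : M) : ℝ :=
  g.inner p (mlieBracket I (e 0) (e 1) p) (e 2 p)

/-- The rotation `e₁ ↦ e₂ ↦ -e₁`, `e₀ ↦ 0` for an orthonormal frame `e` in dimension three. -/
def frameRot (g : Bundle.ContMDiffRiemannianMetric I ∞ E (fun p : M => TangentSpace I p))
    (e : Fin 3 → Π p : M, TangentSpace I p) (p : M) : TangentSpace I p →L[ℝ] TangentSpace I p :=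
  (g.inner p (e 1 p)).smulRight (e 2 p) - (g.inner p (e 2 p)).smulRight (e 1 p)

theorem frameRot_apply (e : Fin 3 → Π p : M, TangentSpace I p) (p : M) (v : TangentSpace I p) :
    frameRot g e p v = g.inner p v (e 1 p) • e 2 p - g.inner p v (e 2 p) • e 1 p := by
  rw [g.symm p v, g.symm p v]
  rfl

namespace IsOrthonormalOn

variable {e : Fin 3 → Π p : M, TangentSpace I p} {U : Set M} {p : M}

theorem frameRot_zero (h : IsOrthonormalOn g.inner e U) (hp : p ∈ U) :
    frameRot g e p (e 0 p) = 0 := by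
  simp [frameRot_apply, h.inner_eq p hp]

theorem frameRot_one (h : IsOrthonormalOn g.inner e U) (hp : p ∈ U) :
    frameRot g e p (e 1 p) = e 2 p := by
  simp [frameRot_apply, h.inner_eq p hp]

theorem frameRot_two (h : IsOrthonormalOn g.inner e U) (hp : p ∈ U) :
    frameRot g e p (e 2 p) = -e 1 p := by
  simp [frameRot_apply, h.inner_eq p hp]

theorem contMDiffOn_frameRot (h : IsOrthonormalOn g.inner e U) {V : Set M} (hVU : V ⊆ U)
    {X : Π p : M, TangentSpace I p} (hX : CMDiff[V] ∞ (T% X)) :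
    CMDiff[V] ∞ (T% (fun p => frameRot g e p (X p))) := by
  have hsmooth (i : Fin 3) : CMDiff[V] ∞ (T% (e i)) := (h.smooth i).mono hVU
  simp only [frameRot_apply]
  exact ((contMDiffOn_inner hX (hsmooth 1)).smul_section (hsmooth 2)).sub_section
    ((contMDiffOn_inner hX (hsmooth 2)).smul_section (hsmooth 1))

theorem contMDiffOn_frameTwist [CompleteSpace E] (h : IsOrthonormalOn g.inner e U) :
    CMDiff[U] ∞ (frameTwist g e) :=
  (contMDiffOn_const (c := (-(1 / 2) : ℝ)) (I' := 𝓘(ℝ, ℝ))).smul (contMDiffOn_inner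
    (contMDiffOn_mlieBracket h.isOpen (h.smooth 1) (h.smooth 2)) (h.smooth 0))

theorem contMDiffOn_frameSpin [CompleteSpace E] (h : IsOrthonormalOn g.inner e U) :
    CMDiff[U] ∞ (frameSpin g e) :=
  contMDiffOn_inner (contMDiffOn_mlieBracket h.isOpen (h.smooth 0) (h.smooth 1)) (h.smooth 2)

theorem inner_mlieBracket_zero_skew (h : IsOrthonormalOn g.inner e U) (hkill : IsKilling g (e 0))
    (hp : p ∈ U) (i j : Fin 3) :
    g.inner p (mlieBracket I (e 0) (e i) p) (e j p)
      = -g.inner p (mlieBracket I (e 0) (e j) p) (e i p) := by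
  have hconst : ∀ᶠ q in 𝓝 p, g.inner q (e i q) (e j q) = if i = j then 1 else 0 := by
    filter_upwards [h.isOpen.mem_nhds hp] with q hq using h.inner_eq q hq i j
  have hij := hkill p (e i) (e j) (h.mdifferentiableAt hp i) (h.mdifferentiableAt hp j)
  rw [mvfderiv_eq_zero_of_eventually_eq_const hconst, zero_apply, g.symm p (e i p)] at hij
  linarith

theorem inner_frameRot_zero (h : IsOrthonormalOn g.inner e U) (hp : p ∈ U) (v : TangentSpace I p) :
    g.inner p (frameRot g e p v) (e 0 p) = 0 := by
  simp [frameRot_apply, h.inner_eq p hp]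

theorem inner_mlieBracket_zero_left (h : IsOrthonormalOn g.inner e U) (hkill : IsKilling g (e 0))
    (hp : p ∈ U) (i : Fin 3) : g.inner p (mlieBracket I (e 0) (e i) p) (e 0 p) = 0 := by
  rw [h.inner_mlieBracket_zero_skew hkill hp, mlieBracket_self]
  simp

theorem inner_mlieBracket_zero_self (h : IsOrthonormalOn g.inner e U) (hkill : IsKilling g (e 0))
    (hp : p ∈ U) (i : Fin 3) : g.inner p (mlieBracket I (e 0) (e i) p) (e i p) = 0 :=
  self_eq_neg.mp (h.inner_mlieBracket_zero_skew hkill hp i i)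

variable [FiniteDimensional ℝ E]

theorem frameRot_frameRot (h : IsOrthonormalOn g.inner e U) (hE : Module.finrank ℝ E = 3)
    (hp : p ∈ U) (v : TangentSpace I p) :
    frameRot g e p (frameRot g e p v) = -(v - g.inner p v (e 0 p) • e 0 p) := by
  have hv := h.expand hE hp v
  rw [Fin.sum_univ_three] at hv
  have hperp : v - g.inner p v (e 0 p) • e 0 p
      = g.inner p v (e 1 p) • e 1 p + g.inner p v (e 2 p) • e 2 p :=
    sub_eq_of_eq_add (hv.trans (by module))
  rw [hperp, frameRot_apply (v := v), map_sub, map_smul, map_smul, h.frameRot_one hp,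
    h.frameRot_two hp]
  module

theorem inner_frameRot_frameRot (h : IsOrthonormalOn g.inner e U) (hE : Module.finrank ℝ E = 3)
    (hp : p ∈ U) (v w : TangentSpace I p) :
    g.inner p (frameRot g e p v) (frameRot g e p w)
      = g.inner p v w - g.inner p v (e 0 p) * g.inner p w (e 0 p) := by
  rw [h.inner_eq_sum hE hp v w, Fin.sum_univ_three]
  simp only [frameRot_apply, map_sub, map_smul, sub_apply, smul_apply, smul_eq_mul,
    h.inner_eq p hp, Fin.reduceEq, if_false, if_true]
  ring

theorem mlieBracket_zero_one (h : IsOrthonormalOn g.inner e U) (hE : Module.finrank ℝ E = 3)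
    (hkill : IsKilling g (e 0)) (hp : p ∈ U) :
    mlieBracket I (e 0) (e 1) p = frameSpin g e p • e 2 p := by
  rw [h.expand hE hp (mlieBracket I (e 0) (e 1) p), Fin.sum_univ_three,
    h.inner_mlieBracket_zero_left hkill hp, h.inner_mlieBracket_zero_self hkill hp, frameSpin]
  module

theorem mlieBracket_zero_two (h : IsOrthonormalOn g.inner e U) (hE : Module.finrank ℝ E = 3)
    (hkill : IsKilling g (e 0)) (hp : p ∈ U) :
    mlieBracket I (e 0) (e 2) p = -(frameSpin g e p • e 1 p) := by
  rw [h.expand hE hp (mlieBracket I (e 0) (e 2) p), Fin.sum_univ_three,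
    h.inner_mlieBracket_zero_left hkill hp, h.inner_mlieBracket_zero_self hkill hp,
    h.inner_mlieBracket_zero_skew hkill hp 2 1, frameSpin]
  module

theorem exteriorDerivative_zero (h : IsOrthonormalOn g.inner e U) (hE : Module.finrank ℝ E = 3)
    (hkill : IsKilling g (e 0)) {X Y : Π p : M, TangentSpace I p} (hp : p ∈ U)
    (hX : MDiffAt (T% X) p) (hY : MDiffAt (T% Y) p) :
    mvfderiv I (fun q => g.inner q (Y q) (e 0 q)) p (X p)
        - mvfderiv I (fun q => g.inner q (X q) (e 0 q)) p (Y p)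
        - g.inner p (mlieBracket I X Y p) (e 0 p)
      = 2 * g.inner p (frameTwist g e p • frameRot g e p (X p)) (Y p) := by
  have hd := h.mdifferentiableAt hp
  have hzero := h.inner_mlieBracket_zero_left hkill hp
  have hzero' (i : Fin 3) : g.inner p (mlieBracket I (e i) (e 0) p) (e 0 p) = 0 := by
    rw [mlieBracket_swap_apply, map_neg, neg_apply, hzero, neg_zero]
  have htwist : g.inner p (mlieBracket I (e 1) (e 2) p) (e 0 p) = -2 * frameTwist g e p := by
    rw [frameTwist]
    ring
  have htwist' : g.inner p (mlieBracket I (e 2) (e 1) p) (e 0 p) = 2 * frameTwist g e p := by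
    rw [mlieBracket_swap_apply, map_neg, neg_apply, htwist]
    ring
  rw [h.inner_mlieBracket hE hp (fun i => mdifferentiableAt_inner hX (hd i))
    (fun i => mdifferentiableAt_inner hY (hd i))]
  simp only [Fin.sum_univ_three, mlieBracket_self, Pi.zero_apply, hzero, hzero', htwist, htwist',
    frameRot_apply, map_smul, map_sub, map_zero, sub_apply, smul_apply, zero_apply, smul_eq_mul]
  rw [g.symm p (e 2 p), g.symm p (e 1 p)]
  ring

theorem leviCivita_zero_right (h : IsOrthonormalOn g.inner e U) (hE : Module.finrank ℝ E = 3)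
    (hkill : IsKilling g (e 0)) {X : Π p : M, TangentSpace I p} (hp : p ∈ U)
    (hX : MDiffAt (T% X) p) :
    leviCivita g X (e 0) p = frameTwist g e p • frameRot g e p (X p) := by
  refine leviCivita_eq fun Z hZ => ?_
  rw [← h.exteriorDerivative_zero hE hkill hp hX hZ, koszul, hkill p X Z hX hZ,
    mlieBracket_swap_apply (V := X) (W := e 0), map_neg, neg_apply,
    g.symm p (mlieBracket I (e 0) Z p)]
  simp only [g.symm _ (e 0 _)]
  ring

theorem leviCivita_zero_left (h : IsOrthonormalOn g.inner e U) (hE : Module.finrank ℝ E = 3)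
    (hkill : IsKilling g (e 0)) {Y : Π p : M, TangentSpace I p} (hp : p ∈ U)
    (hY : MDiffAt (T% Y) p) :
    leviCivita g (e 0) Y p
      = mlieBracket I (e 0) Y p + frameTwist g e p • frameRot g e p (Y p) := by
  refine leviCivita_eq fun Z hZ => ?_
  rw [map_add, add_apply, mul_add, ← h.exteriorDerivative_zero hE hkill hp hY hZ, koszul,
    hkill p Y Z hY hZ, g.symm p (mlieBracket I (e 0) Z p)]
  simp only [g.symm _ (e 0 _)]
  ring

theorem leviCivita_zero_zero (h : IsOrthonormalOn g.inner e U) (hE : Module.finrank ℝ E = 3)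
    (hkill : IsKilling g (e 0)) (hp : p ∈ U) : leviCivita g (e 0) (e 0) p = 0 := by
  rw [h.leviCivita_zero_right hE hkill hp (h.mdifferentiableAt hp 0), h.frameRot_zero hp,
    smul_zero]

theorem inner_mlieBracket_mlieBracket_zero (h : IsOrthonormalOn g.inner e U)
    (hE : Module.finrank ℝ E = 3) (hkill : IsKilling g (e 0)) (hp : p ∈ U) :
    g.inner p (mlieBracket I (e 0) (mlieBracket I (e 1) (e 2)) p) (e 0 p) = 0 := by
  have : CompleteSpace E := FiniteDimensional.complete ℝ E
  have hd := h.mdifferentiableAt hp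
  have hspin := mdifferentiableAt_of_contMDiffOn h.isOpen h.contMDiffOn_frameSpin hp
  have hzero_one : mlieBracket I (e 0) (e 1) =ᶠ[𝓝 p] frameSpin g e • e 2 := by
    filter_upwards [h.isOpen.mem_nhds hp] with q hq using h.mlieBracket_zero_one hE hkill hq
  have hzero_two : mlieBracket I (e 0) (e 2) =ᶠ[𝓝 p] (-frameSpin g e) • e 1 := by
    filter_upwards [h.isOpen.mem_nhds hp] with q hq
    exact (h.mlieBracket_zero_two hE hkill hq).trans (neg_smul _ _).symm
  rw [mlieBracket_jacobi h.isOpen (h.smooth 0) (h.smooth 1) (h.smooth 2) hp,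
    hzero_one.mlieBracket_vectorField_eq (Filter.EventuallyEq.refl (𝓝 p) (e 2)),
    (Filter.EventuallyEq.refl (𝓝 p) (e 1)).mlieBracket_vectorField_eq hzero_two,
    mlieBracket_smul_left hspin (hd 2), mlieBracket_smul_right hspin.neg (hd 1),
    mlieBracket_self, mlieBracket_self]
  simp [h.inner_eq p hp]

theorem mvfderiv_frameTwist_zero (h : IsOrthonormalOn g.inner e U) (hE : Module.finrank ℝ E = 3)
    (hkill : IsKilling g (e 0)) (hp : p ∈ U) : mvfderiv I (frameTwist g e) p (e 0 p) = 0 := by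
  have : CompleteSpace E := FiniteDimensional.complete ℝ E
  have hbracket := mdifferentiableAt_of_contMDiffOn h.isOpen
    (contMDiffOn_mlieBracket h.isOpen (h.smooth 1) (h.smooth 2)) hp
  have hd := h.mdifferentiableAt hp 0
  have hinv := hkill p _ (e 0) hbracket hd
  rw [h.inner_mlieBracket_mlieBracket_zero hE hkill hp, mlieBracket_self, Pi.zero_apply, map_zero,
    add_zero] at hinv
  have hsmul : frameTwist g e = (fun _ : M => -(1 / 2 : ℝ)) •
      fun q : M => g.inner q (mlieBracket I (e 1) (e 2) q) (e 0 q) := rfl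
  rw [hsmul, mvfderiv_smul mdifferentiableAt_const (mdifferentiableAt_inner hbracket hd),
    mvfderiv_const]
  simp [hinv]

theorem mlieBracket_frameRot (h : IsOrthonormalOn g.inner e U) (hE : Module.finrank ℝ E = 3)
    (hkill : IsKilling g (e 0)) {X : Π p : M, TangentSpace I p} (hp : p ∈ U)
    (hX : MDiffAt (T% X) p) :
    mlieBracket I (e 0) (fun q => frameRot g e q (X q)) p
      = frameRot g e p (mlieBracket I (e 0) X p) := by
  have hd := h.mdifferentiableAt hp
  have hx (i : Fin 3) : MDiffAt (fun q => g.inner q (X q) (e i q)) p :=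
    mdifferentiableAt_inner hX (hd i)
  have hrot : (fun q => frameRot g e q (X q)) = (fun q => g.inner q (X q) (e 1 q)) • e 2
      + (-fun q => g.inner q (X q) (e 2 q)) • e 1 := by
    funext q
    simp [frameRot_apply, sub_eq_add_neg]
  have hderiv (i : Fin 3) : mvfderiv I (fun q => g.inner q (X q) (e i q)) p (e 0 p)
      = g.inner p (mlieBracket I (e 0) X p) (e i p)
        + g.inner p (X p) (mlieBracket I (e 0) (e i) p) := hkill p X (e i) hX (hd i)
  have hneg : mvfderiv I (-fun q => g.inner q (X q) (e 2 q)) p (e 0 p)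
      = -mvfderiv I (fun q => g.inner q (X q) (e 2 q)) p (e 0 p) := by simp [mvfderiv_neg]
  rw [hrot, mlieBracket_add_right ((hx 1).smul_section (hd 2)) ((hx 2).neg.smul_section (hd 1)),
    mlieBracket_smul_right (hx 1) (hd 2), mlieBracket_smul_right (hx 2).neg (hd 1), hneg,
    hderiv, hderiv, h.mlieBracket_zero_one hE hkill hp,
    h.mlieBracket_zero_two hE hkill hp, frameRot_apply, map_neg (g.inner p (X p))]
  simp only [map_smul, smul_eq_mul, Pi.neg_apply]
  module

theorem mlieBracket_frameTwist_smul_frameRot (h : IsOrthonormalOn g.inner e U)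
    (hE : Module.finrank ℝ E = 3) (hkill : IsKilling g (e 0)) {X : Π p : M, TangentSpace I p}
    {V : Set M} (hV : IsOpen V) (hVU : V ⊆ U) (hX : CMDiff[V] ∞ (T% X)) (hp : p ∈ V) :
    mlieBracket I (e 0) (fun q => frameTwist g e q • frameRot g e q (X q)) p
      = frameTwist g e p • frameRot g e p (mlieBracket I (e 0) X p) := by
  have : CompleteSpace E := FiniteDimensional.complete ℝ E
  have hleibniz := mlieBracket_smul_right (V := e 0)
    (mdifferentiableAt_of_contMDiffOn h.isOpen h.contMDiffOn_frameTwist (hVU hp))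
    (mdifferentiableAt_of_contMDiffOn hV (h.contMDiffOn_frameRot hVU hX) hp)
  rw [h.mvfderiv_frameTwist_zero hE hkill (hVU hp), zero_smul, zero_add,
    h.mlieBracket_frameRot hE hkill (hVU hp) (mdifferentiableAt_of_contMDiffOn hV hX hp)]
    at hleibniz
  exact hleibniz

theorem curvature_zero_zero (h : IsOrthonormalOn g.inner e U) (hE : Module.finrank ℝ E = 3)
    (hkill : IsKilling g (e 0)) {X : Π p : M, TangentSpace I p} {V : Set M} (hV : IsOpen V)
    (hVU : V ⊆ U) (hX : CMDiff[V] ∞ (T% X)) (hp : p ∈ V) :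
    curvature g X (e 0) (e 0) p
      = frameTwist g e p ^ 2 • (X p - g.inner p (X p) (e 0 p) • e 0 p) := by
  have : CompleteSpace E := FiniteDimensional.complete ℝ E
  have hbracket : CMDiff[V] ∞ (T% (mlieBracket I X (e 0))) :=
    contMDiffOn_mlieBracket hV hX ((h.smooth 0).mono hVU)
  have hrot : CMDiff[V] ∞ (T% (fun q => frameTwist g e q • frameRot g e q (X q))) :=
    (h.contMDiffOn_frameTwist.mono hVU).smul_section (h.contMDiffOn_frameRot hVU hX)
  have hgeodesic : leviCivita g (e 0) (e 0) =ᶠ[𝓝 p] (0 : Π q : M, TangentSpace I q) := by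
    filter_upwards [hV.mem_nhds hp] with q hq using h.leviCivita_zero_zero hE hkill (hVU hq)
  have hderiv : leviCivita g X (e 0) =ᶠ[𝓝 p] fun q => frameTwist g e q • frameRot g e q (X q) := by
    filter_upwards [hV.mem_nhds hp] with q hq using
      h.leviCivita_zero_right hE hkill (hVU hq) (mdifferentiableAt_of_contMDiffOn hV hX hq)
  rw [curvature, leviCivita_congr hgeodesic, SasakiCone.leviCivita_zero_right,
    leviCivita_congr hderiv,
    h.leviCivita_zero_left hE hkill (hVU hp) (mdifferentiableAt_of_contMDiffOn hV hrot hp),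
    h.leviCivita_zero_right hE hkill (hVU hp) (mdifferentiableAt_of_contMDiffOn hV hbracket hp),
    h.mlieBracket_frameTwist_smul_frameRot hE hkill hV hVU hX hp,
    mlieBracket_swap_apply (V := X), map_smul, h.frameRot_frameRot hE (hVU hp), map_neg]
  module

theorem curvature_extend_zero_zero (h : IsOrthonormalOn g.inner e U)
    (hE : Module.finrank ℝ E = 3) (hkill : IsKilling g (e 0)) (hp : p ∈ U)
    (v : TangentSpace I p) :
    curvature g (FiberBundle.extend E v) (e 0) (e 0) p
      = frameTwist g e p ^ 2 • (v - g.inner p v (e 0 p) • e 0 p) := by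
  obtain ⟨s, hs, hsmooth⟩ := FiberBundle.exists_contMDiffOn_extend (k := ∞) I E v
  obtain ⟨V, hVs, hV, hpV⟩ := mem_nhds_iff.mp hs
  rw [h.curvature_zero_zero hE hkill (hV.inter h.isOpen) inter_subset_right
    ((hsmooth.mono hVs).mono inter_subset_left) ⟨hpV, hp⟩, FiberBundle.extend_apply_self]

end IsOrthonormalOn

theorem sum_coord_mul_inner {ι : Type*} [Fintype ι] {p : M}
    (b : Module.Basis ι ℝ (TangentSpace I p)) (v w : TangentSpace I p) :
    ∑ i, b.coord i v * g.inner p (b i) w = g.inner p v w := by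
  have hv := congrArg (fun u => g.inner p u w) (b.sum_repr v)
  simp only [map_sum, map_smul, sum_apply, smul_apply, smul_eq_mul] at hv
  exact hv

theorem IsOrthonormalOn.ricciFunction_zero [FiniteDimensional ℝ E]
    {e : Fin 3 → Π p : M, TangentSpace I p} {U : Set M} {p : M} (h : IsOrthonormalOn g.inner e U)
    (hE : Module.finrank ℝ E = 3) (hkill : IsKilling g (e 0)) (hp : p ∈ U) :
    ricciFunction g (e 0) p = frameTwist g e p ^ 2 := by
  set b : Module.Basis _ ℝ (TangentSpace I p) := Module.finBasis ℝ E
  have hcoord (i) : b.coord i (curvature g (FiberBundle.extend E (b i)) (e 0) (e 0) p)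
      = frameTwist g e p ^ 2 * (1 - b.coord i (e 0 p) * g.inner p (b i) (e 0 p)) := by
    rw [h.curvature_extend_zero_zero hE hkill hp]
    simp only [map_smul, map_sub, Module.Basis.coord_apply, Module.Basis.repr_self,
      Finsupp.single_eq_same, smul_eq_mul]
    ring
  have hricci : ricci g (e 0) (e 0) p = frameTwist g e p ^ 2 * 2 := by
    refine (Finset.sum_congr rfl fun i _ => hcoord i).trans ?_
    rw [← Finset.mul_sum, Finset.sum_sub_distrib, sum_coord_mul_inner, h.inner_eq p hp]
    norm_num [hE]
  rw [ricciFunction, hricci, hE]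
  norm_num

end KillingFrame

section Transverse

variable {E : Type*} [NormedAddCommGroup E] [NormedSpace ℝ E]
  {H : Type*} [TopologicalSpace H] {I : ModelWithCorners ℝ E H}
  {M : Type*} [TopologicalSpace M] [ChartedSpace H M] [IsManifold I ∞ M]
  {g : Bundle.ContMDiffRiemannianMetric I ∞ E (fun p : M => TangentSpace I p)}

theorem frameTwist_comp_swap (e : Fin 3 → Π p : M, TangentSpace I p) (p : M) :
    frameTwist g (e ∘ Equiv.swap 1 2) p = -frameTwist g e p := by
  have hswap : mlieBracket I ((e ∘ Equiv.swap 1 2) 1) ((e ∘ Equiv.swap 1 2) 2) p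
      = -mlieBracket I (e 1) (e 2) p := mlieBracket_swap_apply
  rw [frameTwist, frameTwist, hswap, map_neg, neg_apply, mul_neg]
  rfl

/-- `e` is a smooth orthonormal frame on `U` with first field `ξ` and negative twist. The sign fixes
the orientation of `ξ^⊥`, so that all adapted frames have the same rotation. -/
structure IsAdaptedFrameOn
    (g : Bundle.ContMDiffRiemannianMetric I ∞ E (fun p : M => TangentSpace I p))
    (ξ : Π p : M, TangentSpace I p) (e : Fin 3 → Π p : M, TangentSpace I p) (U : Set M) : Prop
    extends IsOrthonormalOn g.inner e U where
  zero_eq : e 0 = ξ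
  frameTwist_neg : ∀ p ∈ U, frameTwist g e p < 0

/-- `j` is the rotation by a right angle in `ξ^⊥`, extended by `j ξ = 0`, for the orientation of
`ξ^⊥` given by the adapted frames. -/
def IsTransverseRotation
    (g : Bundle.ContMDiffRiemannianMetric I ∞ E (fun p : M => TangentSpace I p))
    (ξ : Π p : M, TangentSpace I p) (j : Π p : M, TangentSpace I p →L[ℝ] TangentSpace I p) : Prop :=
  ∀ e U, IsAdaptedFrameOn g ξ e U → ∀ p ∈ U, j p = frameRot g e p

variable [FiniteDimensional ℝ E] {ξ : Π p : M, TangentSpace I p}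

theorem exists_isAdaptedFrameOn (hE : Module.finrank ℝ E = 3) (hξ : CMDiff ∞ (T% ξ))
    (hunit : ∀ p, g.inner p (ξ p) (ξ p) = 1) (hkill : IsKilling g ξ) {p : M}
    (hpos : 0 < ricciFunction g ξ p) :
    ∃ e U, p ∈ U ∧ IsAdaptedFrameOn g ξ e U := by
  have : CompleteSpace E := FiniteDimensional.complete ℝ E
  obtain ⟨e, U, hpU, h, rfl⟩ := exists_orthonormal_frame_zero_eq hE hξ hunit p
  rw [h.ricciFunction_zero hE hkill hpU, sq_pos_iff] at hpos
  have hexists {e' : Fin 3 → Π p : M, TangentSpace I p} (h' : IsOrthonormalOn g.inner e' U)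
      (hzero : e' 0 = e 0) (hneg : frameTwist g e' p < 0) :
      ∃ e'' V, p ∈ V ∧ IsAdaptedFrameOn g (e 0) e'' V :=
    have hV := h'.contMDiffOn_frameTwist.continuousOn.isOpen_inter_preimage h'.isOpen isOpen_Iio
    ⟨e', U ∩ frameTwist g e' ⁻¹' Iio 0, ⟨hpU, hneg⟩, h'.mono hV inter_subset_left, hzero,
      fun _ hq => hq.2⟩
  rcases hpos.lt_or_gt with hneg | hpos
  · exact hexists h rfl hneg
  · refine hexists (h.comp_perm (Equiv.swap 1 2)) rfl ?_
    rw [frameTwist_comp_swap]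
    exact neg_neg_of_pos hpos

namespace IsAdaptedFrameOn

variable {e e' : Fin 3 → Π p : M, TangentSpace I p} {U U' : Set M} {p : M}

theorem frameTwist_eq (h : IsAdaptedFrameOn g ξ e U) (hE : Module.finrank ℝ E = 3)
    (hkill : IsKilling g ξ) (hp : p ∈ U) : frameTwist g e p = -√(ricciFunction g ξ p) := by
  obtain rfl := h.zero_eq
  rw [h.ricciFunction_zero hE hkill hp, Real.sqrt_sq_eq_abs, abs_of_neg (h.frameTwist_neg p hp),
    neg_neg]

theorem frameRot_eq (h : IsAdaptedFrameOn g ξ e U) (h' : IsAdaptedFrameOn g ξ e' U')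
    (hE : Module.finrank ℝ E = 3) (hkill : IsKilling g ξ) (hp : p ∈ U) (hp' : p ∈ U') :
    frameRot g e p = frameRot g e' p := by
  ext v
  have hv := FiberBundle.mdifferentiableAt_extend I E v
  have hD {e : Fin 3 → Π p : M, TangentSpace I p} {U : Set M} (h : IsAdaptedFrameOn g ξ e U)
      (hp : p ∈ U) : leviCivita g (FiberBundle.extend E v) ξ p
        = -√(ricciFunction g ξ p) • frameRot g e p v := by
    rw [← h.frameTwist_eq hE hkill hp]
    obtain rfl := h.zero_eq
    rw [h.leviCivita_zero_right hE hkill hp hv, FiberBundle.extend_apply_self]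
  have hne : -√(ricciFunction g ξ p) ≠ 0 :=
    h.frameTwist_eq hE hkill hp ▸ (h.frameTwist_neg p hp).ne
  exact smul_right_injective _ hne ((hD h hp).symm.trans (hD h' hp'))

end IsAdaptedFrameOn

variable (hE : Module.finrank ℝ E = 3) (hξ : CMDiff ∞ (T% ξ))
  (hunit : ∀ p, g.inner p (ξ p) (ξ p) = 1) (hkill : IsKilling g ξ)
  (hpos : ∀ p, 0 < ricciFunction g ξ p)

include hE hξ hunit hkill hpos

theorem exists_isTransverseRotation : ∃ j, IsTransverseRotation g ξ j := by
  choose e U hp h using fun p => exists_isAdaptedFrameOn hE hξ hunit hkill (hpos p)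
  exact ⟨fun p => frameRot g (e p) p, fun _ _ h' p hp' => (h p).frameRot_eq h' hE hkill (hp p) hp'⟩

theorem IsTransverseRotation.isTransverseComplexStructure
    {j : Π p : M, TangentSpace I p →L[ℝ] TangentSpace I p} (hj : IsTransverseRotation g ξ j) :
    IsTransverseComplexStructure g ξ j := by
  have hframe (p : M) := exists_isAdaptedFrameOn hE hξ hunit hkill (hpos p)
  refine
    { smooth := fun V X hV hX p hpV => ?_
      apply_xi := fun p => ?_
      mem_perp := fun p v => ?_
      sq := fun p v hv => ?_
      orthogonal := fun p v w hv _ => ?_ }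
  all_goals
    obtain ⟨e, U, hpU, h⟩ := hframe p
    have hjU := hj e U h
    obtain rfl := h.zero_eq
  · have hsmooth : CMDiff[V ∩ U] ∞ (T% (fun q => j q (X q))) :=
      (h.contMDiffOn_frameRot inter_subset_right (hX.mono inter_subset_left)).congr
        fun q hq => by rw [hjU q hq.2]
    exact (hsmooth.contMDiffAt ((hV.inter h.isOpen).mem_nhds ⟨hpV, hpU⟩)).contMDiffWithinAt
  · rw [hjU p hpU, h.frameRot_zero hpU]
  · rw [hjU p hpU, h.inner_frameRot_zero hpU]
  · rw [hjU p hpU, h.frameRot_frameRot hE hpU, hv, zero_smul, sub_zero]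
  · rw [hjU p hpU, h.inner_frameRot_frameRot hE hpU, hv, zero_mul, sub_zero]

end Transverse

noncomputable section IntegrabilityAndClosedness

variable {E : Type*} [NormedAddCommGroup E] [NormedSpace ℝ E]
  {H : Type*} [TopologicalSpace H] {I : ModelWithCorners ℝ E H}
  {N : Type*} [TopologicalSpace N] [ChartedSpace H N]
  {G : Π x : N, TangentSpace I x →L[ℝ] TangentSpace I x →L[ℝ] ℝ}
  {J : Π x : N, TangentSpace I x →L[ℝ] TangentSpace I x} {X Y Z : Π x : N, TangentSpace I x} {x : N}

variable (I) in
/-- The exterior derivative `dθ(X, Y)` of the 1-form `θ`. -/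
def dOneForm (θ : Π x : N, TangentSpace I x →L[ℝ] ℝ) (X Y : Π x : N, TangentSpace I x) (x : N) :
    ℝ :=
  mvfderiv I (fun y => θ y (Y y)) x (X x) - mvfderiv I (fun y => θ y (X y)) x (Y x)
    - θ x (mlieBracket I X Y x)

theorem nijenhuis_swap (X Y : Π x : N, TangentSpace I x) (x : N) :
    nijenhuis I J X Y x = -nijenhuis I J Y X x := by
  simp only [nijenhuis, mlieBracket_swap_apply (V := Y) (W := X),
    mlieBracket_swap_apply (V := Y) (W := fun y => J y (X y)),
    mlieBracket_swap_apply (V := fun y => J y (Y y)) (W := X),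
    mlieBracket_swap_apply (V := fun y => J y (Y y)) (W := fun y => J y (X y)), map_neg]
  abel

theorem nijenhuis_self (X : Π x : N, TangentSpace I x) (x : N) : nijenhuis I J X X x = 0 := by
  rw [nijenhuis, mlieBracket_self, mlieBracket_self,
    mlieBracket_swap_apply (V := X) (W := fun y => J y (X y))]
  simp

variable [IsManifold I ∞ N]

theorem mdifferentiableAt_apply_of_contMDiffOn [FiniteDimensional ℝ E] {U : Set N}
    (hU : IsOpen U) (hJ : ∀ (V : Set N) (Z : Π x : N, TangentSpace I x), IsOpen V → V ⊆ U →
      CMDiff[V] ∞ (T% Z) → CMDiff[V] ∞ (T% (fun y => J y (Z y))))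
    (hx : x ∈ U) (hX : MDiffAt (T% X) x) : MDiffAt (T% (fun y => J y (X y))) x := by
  let b := Module.finBasis ℝ E
  let T := trivializationAt E (TangentSpace I : N → Type _) x
  have hxT : x ∈ T.baseSet := FiberBundle.mem_baseSet_trivializationAt' x
  have hTU : IsOpen (T.baseSet ∩ U) := T.open_baseSet.inter hU
  have hs (i) : MDiffAt (T% (fun y => J y (T.localFrame b i y))) x :=
    mdifferentiableAt_of_contMDiffOn hTU (hJ _ _ hTU inter_subset_right
      ((T.contMDiffOn_localFrame_baseSet ∞ b i).mono inter_subset_left)) ⟨hxT, hx⟩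
  have hsum : MDiffAt (T% (fun y => ∑ i, T.localFrameCoeff I b i y (X y) •
      J y (T.localFrame b i y))) x :=
    MDifferentiableAt.sum_section fun i _ =>
      (mdifferentiableAt_localFrameCoeff b hxT hX i).smul_section (hs i)
  refine hsum.congr_of_eventuallyEq ?_
  filter_upwards [T.eventually_eq_localFrame_sum_coeff_smul (I := I) b hxT (s := X)] with y hy
  conv_lhs => rw [hy]
  simp [map_sum]

theorem IsOrthonormalOn.eq_zero_of_tensorialAt [FiniteDimensional ℝ E] {n : ℕ}
    {e : Fin n → Π x : N, TangentSpace I x} {U : Set N} (h : IsOrthonormalOn G e U)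
    (hE : Module.finrank ℝ E = n) {A : Type*} [AddCommGroup A] [Module ℝ A]
    {Φ : (Π x : N, TangentSpace I x) → A} (hx : x ∈ U) (hΦ : TensorialAt I E Φ x)
    (hΦe : ∀ i, Φ (e i) = 0) (hX : MDiffAt (T% X) x) : Φ X = 0 := by
  let a (i : Fin n) : N → ℝ := fun _ => G x (X x) (e i x)
  have ha (i : Fin n) : MDiffAt (a i) x := mdifferentiableAt_const
  have hae (i : Fin n) : MDiffAt (T% (a i • e i)) x :=
    (ha i).smul_section (h.mdifferentiableAt hx i)
  calc Φ X = Φ (fun y => ∑ i, (a i • e i) y) :=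
        hΦ.pointwise hX (MDifferentiableAt.sum_section fun i _ => hae i) (h.expand hE hx (X x))
    _ = ∑ i, a i x • Φ (e i) := by
        rw [hΦ.sum _ fun i _ => hae i]
        exact Finset.sum_congr rfl fun i _ => hΦ.smul (ha i) (h.mdifferentiableAt hx i)
    _ = 0 := by simp [hΦe]

variable [CompleteSpace E]

theorem nijenhuis_comp_left (hsq : ∀ᶠ y in 𝓝 x, ∀ v, J y (J y v) = -v) (hX : MDiffAt (T% X) x) :
    nijenhuis I J (fun y => J y (X y)) Y x = -J x (nijenhuis I J X Y x) := by
  have hJJX : (fun y => J y (J y (X y))) =ᶠ[𝓝 x] (-1 : ℝ) • X := by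
    filter_upwards [hsq] with y hy
    rw [hy, Pi.smul_apply, neg_smul, one_smul]
  have hneg (Z : Π x : N, TangentSpace I x) :
      mlieBracket I (fun y => J y (J y (X y))) Z x = -mlieBracket I X Z x := by
    rw [hJJX.mlieBracket_vectorField_eq (Filter.EventuallyEq.refl _ Z),
      mlieBracket_const_smul_left hX, neg_smul, one_smul]
  simp only [nijenhuis, hneg, map_neg, map_sub, hsq.self_of_nhds]
  abel

theorem tensorialAt_nijenhuis_left
    (hJ : ∀ Z : Π x : N, TangentSpace I x, MDiffAt (T% Z) x → MDiffAt (T% (fun y => J y (Z y))) x)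
    (hsq : ∀ v, J x (J x v) = -v) (Y : Π x : N, TangentSpace I x) :
    TensorialAt I E (fun X => nijenhuis I J X Y x) x where
  smul {f X} hf hX := by
    have hJfX : (fun y => J y ((f • X) y)) = f • fun y => J y (X y) := by
      ext y
      simp
    simp only [nijenhuis, hJfX, mlieBracket_smul_left hf hX, mlieBracket_smul_left hf (hJ X hX),
      map_add, map_smul, hsq]
    module
  add {X X'} hX hX' := by
    have hJadd : (fun y => J y ((X + X') y)) = (fun y => J y (X y)) + fun y => J y (X' y) := by
      ext y
      simp
    simp only [nijenhuis, hJadd, mlieBracket_add_left hX hX',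
      mlieBracket_add_left (hJ X hX) (hJ X' hX'), map_add]
    abel

theorem dFundamentalForm_eq_zero_of_eq_dOneForm {θ : Π x : N, TangentSpace I x →L[ℝ] ℝ}
    {V : Set N} (hV : IsOpen V)
    (hθ : ∀ Z : Π x : N, TangentSpace I x, CMDiff[V] ∞ (T% Z) →
      CMDiff[V] ∞ (fun y => θ y (Z y)))
    (hΩ : ∀ A B : Π x : N, TangentSpace I x, CMDiff[V] ∞ (T% A) → CMDiff[V] ∞ (T% B) →
      ∀ y ∈ V, G y (J y (A y)) (B y) = dOneForm I θ A B y)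
    (hX : CMDiff[V] ∞ (T% X)) (hY : CMDiff[V] ∞ (T% Y)) (hZ : CMDiff[V] ∞ (T% Z)) (hx : x ∈ V) :
    dFundamentalForm I G J X Y Z x = 0 := by
  have hd {A B : Π x : N, TangentSpace I x} (hA : CMDiff[V] ∞ (T% A)) (hB : CMDiff[V] ∞ (T% B)) :
      MDiffAt (fun y => mvfderiv I (fun y => θ y (B y)) y (A y)) x :=
    mdifferentiableAt_of_contMDiffOn hV (contMDiffOn_mvfderiv_apply hV (hθ B hB) hA) hx
  have hΩ' {A B : Π x : N, TangentSpace I x} (hA : CMDiff[V] ∞ (T% A)) (hB : CMDiff[V] ∞ (T% B))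
      (v : TangentSpace I x) : mvfderiv I (fun y => G y (J y (A y)) (B y)) x v
        = mvfderiv I (fun y => mvfderiv I (fun y => θ y (B y)) y (A y)) x v
          - mvfderiv I (fun y => mvfderiv I (fun y => θ y (A y)) y (B y)) x v
          - mvfderiv I (fun y => θ y (mlieBracket I A B y)) x v := by
    have hθAB := mdifferentiableAt_of_contMDiffOn hV (hθ _ (contMDiffOn_mlieBracket hV hA hB)) hx
    have hloc : (fun y => G y (J y (A y)) (B y)) =ᶠ[𝓝 x]
        (fun y => mvfderiv I (fun y => θ y (B y)) y (A y))
          - (fun y => mvfderiv I (fun y => θ y (A y)) y (B y))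
          - fun y => θ y (mlieBracket I A B y) := by
      filter_upwards [hV.mem_nhds hx] with y hy using hΩ A B hA hB y hy
    rw [mvfderiv_congr_of_eventuallyEq hloc, mvfderiv_sub ((hd hA hB).sub (hd hB hA)) hθAB,
      mvfderiv_sub (hd hA hB) (hd hB hA)]
    rfl
  have hXY := contMDiffOn_mlieBracket hV hX hY
  have hXZ := contMDiffOn_mlieBracket hV hX hZ
  have hYZ := contMDiffOn_mlieBracket hV hY hZ
  have hjacobi := congrArg (θ x) (mlieBracket_jacobi hV hX hY hZ hx)
  rw [mlieBracket_swap_apply, mlieBracket_swap_apply (V := Y) (W := mlieBracket I X Z), map_add,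
    map_neg, map_neg] at hjacobi
  rw [dFundamentalForm, hΩ' hY hZ, hΩ' hX hZ, hΩ' hX hY, hΩ _ _ hXY hZ x hx, hΩ _ _ hXZ hY x hx,
    hΩ _ _ hYZ hX x hx]
  simp only [dOneForm, mvfderiv_mlieBracket hV (hθ Z hZ) hX hY hx,
    mvfderiv_mlieBracket hV (hθ Y hY) hX hZ hx, mvfderiv_mlieBracket hV (hθ X hX) hY hZ hx]
  linarith

end IntegrabilityAndClosedness

section HermitianFrame

variable {E : Type*} [NormedAddCommGroup E] [NormedSpace ℝ E]
  {H : Type*} [TopologicalSpace H] {I : ModelWithCorners ℝ E H}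
  {N : Type*} [TopologicalSpace N] [ChartedSpace H N] [IsManifold I ∞ N]

/-- `F` is a smooth orthonormal frame for `G` on the open set `W` with `J F₀ = F₃`, `J F₁ = F₂`
and `J² = -1`. The numbering puts the cone direction last, so that the first three fields come from
the base of a cone. -/
structure IsHermitianFrameOn (G : Π x : N, TangentSpace I x →L[ℝ] TangentSpace I x →L[ℝ] ℝ)
    (J : Π x : N, TangentSpace I x →L[ℝ] TangentSpace I x)
    (F : Fin 4 → Π x : N, TangentSpace I x) (W : Set N) : Prop
    extends IsOrthonormalOn G F W where
  J_zero : ∀ x ∈ W, J x (F 0 x) = F 3 x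
  J_one : ∀ x ∈ W, J x (F 1 x) = F 2 x
  J_two : ∀ x ∈ W, J x (F 2 x) = -F 1 x
  J_three : ∀ x ∈ W, J x (F 3 x) = -F 0 x

namespace IsHermitianFrameOn

variable {G : Π x : N, TangentSpace I x →L[ℝ] TangentSpace I x →L[ℝ] ℝ}
  {J : Π x : N, TangentSpace I x →L[ℝ] TangentSpace I x}
  {F : Fin 4 → Π x : N, TangentSpace I x} {W : Set N} [FiniteDimensional ℝ E] {x : N}

theorem J_apply (h : IsHermitianFrameOn G J F W) (hE : Module.finrank ℝ E = 4) (hx : x ∈ W)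
    (v : TangentSpace I x) :
    J x v = ∑ i, (![-1, -1, 1, 1] i * G x v (F i.rev x)) • F i x := by
  conv_lhs => rw [h.expand hE hx v]
  simp only [Fin.sum_univ_four, map_add, map_smul, h.J_zero x hx, h.J_one x hx, h.J_two x hx,
    h.J_three x hx, Matrix.cons_val, Fin.reduceRev]
  module

theorem inner_J (h : IsHermitianFrameOn G J F W) (hE : Module.finrank ℝ E = 4) (hx : x ∈ W)
    (v : TangentSpace I x) (i : Fin 4) :
    G x (J x v) (F i x) = ![-1, -1, 1, 1] i * G x v (F i.rev x) := by
  rw [h.J_apply hE hx, h.inner_sum_left hx]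

theorem inner_J_apply (h : IsHermitianFrameOn G J F W) (hE : Module.finrank ℝ E = 4) (hx : x ∈ W)
    (v w : TangentSpace I x) :
    G x (J x v) w
      = G x v (F 0 x) * G x w (F 3 x) - G x v (F 3 x) * G x w (F 0 x)
        + (G x v (F 1 x) * G x w (F 2 x) - G x v (F 2 x) * G x w (F 1 x)) := by
  rw [h.inner_eq_sum hE hx]
  simp only [h.inner_J hE hx, Fin.sum_univ_four, Matrix.cons_val, Fin.reduceRev]
  ring

theorem J_J (h : IsHermitianFrameOn G J F W) (hE : Module.finrank ℝ E = 4) (hx : x ∈ W)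
    (v : TangentSpace I x) : J x (J x v) = -v := by
  rw [h.J_apply hE hx (J x v)]
  conv_rhs => rw [h.expand hE hx v]
  simp only [h.inner_J hE hx, Fin.sum_univ_four, Matrix.cons_val, Fin.reduceRev]
  module

theorem inner_J_J (h : IsHermitianFrameOn G J F W) (hE : Module.finrank ℝ E = 4) (hx : x ∈ W)
    (v w : TangentSpace I x) : G x (J x v) (J x w) = G x v w := by
  rw [h.inner_eq_sum hE hx, h.inner_eq_sum hE hx v w]
  simp only [h.inner_J hE hx, Fin.sum_univ_four, Matrix.cons_val, Fin.reduceRev]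
  ring

theorem contMDiffOn_J (h : IsHermitianFrameOn G J F W) (hE : Module.finrank ℝ E = 4) {V : Set N}
    (hVW : V ⊆ W) {X : Π x : N, TangentSpace I x}
    (hX : ∀ i, CMDiff[V] ∞ (fun y => G y (X y) (F i y))) :
    CMDiff[V] ∞ (T% (fun y => J y (X y))) := by
  have hsum : CMDiff[V] ∞ (T% (fun y => ∑ i,
      (![-1, -1, 1, 1] i * G y (X y) (F i.rev y)) • F i y)) :=
    ContMDiffOn.sum_section fun i _ =>
      (contMDiffOn_const.mul (hX i.rev)).smul_section ((h.smooth i).mono hVW)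
  refine hsum.congr fun y hy => ?_
  rw [h.J_apply hE (hVW hy)]

theorem nijenhuis_eq_zero_of_left (h : IsHermitianFrameOn G J F W)
    (hE : Module.finrank ℝ E = 4) (hx : x ∈ W)
    (hJ : ∀ Z : Π x : N, TangentSpace I x, MDiffAt (T% Z) x → MDiffAt (T% (fun y => J y (Z y))) x)
    {X Y : Π x : N, TangentSpace I x} (h₀ : nijenhuis I J (F 0) Y x = 0)
    (h₁ : nijenhuis I J (F 1) Y x = 0) (hX : MDiffAt (T% X) x) : nijenhuis I J X Y x = 0 := by
  have : CompleteSpace E := FiniteDimensional.complete ℝ E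
  have hsq : ∀ᶠ y in 𝓝 x, ∀ v, J y (J y v) = -v := by
    filter_upwards [h.isOpen.mem_nhds hx] with y hy using h.J_J hE hy
  have hF (i : Fin 4) : MDiffAt (T% (F i)) x := h.mdifferentiableAt hx i
  have htensor := tensorialAt_nijenhuis_left hJ hsq.self_of_nhds Y
  have hcomp {i k : Fin 4} (hik : J x (F i x) = F k x) (hi : nijenhuis I J (F i) Y x = 0) :
      nijenhuis I J (F k) Y x = 0 := by
    rw [← htensor.pointwise (hJ _ (hF i)) (hF k) hik, nijenhuis_comp_left hsq (hF i), hi, map_zero,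
      neg_zero]
  refine h.eq_zero_of_tensorialAt hE hx htensor (fun i => ?_) hX
  fin_cases i
  exacts [h₀, h₁, hcomp (h.J_one x hx) h₁, hcomp (h.J_zero x hx) h₀]

theorem nijenhuis_eq_zero (h : IsHermitianFrameOn G J F W) (hE : Module.finrank ℝ E = 4)
    (hx : x ∈ W)
    (hJ : ∀ Z : Π x : N, TangentSpace I x, MDiffAt (T% Z) x → MDiffAt (T% (fun y => J y (Z y))) x)
    (hF : nijenhuis I J (F 0) (F 1) x = 0) {X Y : Π x : N, TangentSpace I x}
    (hX : MDiffAt (T% X) x) (hY : MDiffAt (T% Y) x) : nijenhuis I J X Y x = 0 := by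
  have hF' : nijenhuis I J (F 1) (F 0) x = 0 := by rw [nijenhuis_swap, hF, neg_zero]
  refine h.nijenhuis_eq_zero_of_left hE hx hJ ?_ ?_ hX <;> rw [nijenhuis_swap, neg_eq_zero]
  · exact h.nijenhuis_eq_zero_of_left hE hx hJ (nijenhuis_self _ x) hF' hY
  · exact h.nijenhuis_eq_zero_of_left hE hx hJ hF (nijenhuis_self _ x) hY

end IsHermitianFrameOn

theorem isKahlerOn_of_isHermitianFrameOn [FiniteDimensional ℝ E] (hE : Module.finrank ℝ E = 4)
    {G : Π x : N, TangentSpace I x →L[ℝ] TangentSpace I x →L[ℝ] ℝ}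
    {J : Π x : N, TangentSpace I x →L[ℝ] TangentSpace I x} {θ : Π x : N, TangentSpace I x →L[ℝ] ℝ}
    {U : Set N} (hU : IsOpen U)
    (hG : ∀ (V : Set N) (X Y : Π x : N, TangentSpace I x), IsOpen V → V ⊆ U → CMDiff[V] ∞ (T% X) →
      CMDiff[V] ∞ (T% Y) → CMDiff[V] ∞ (fun x => G x (X x) (Y x)))
    (hF : ∀ x ∈ U, ∃ F W, x ∈ W ∧ IsHermitianFrameOn G J F W ∧ nijenhuis I J (F 0) (F 1) x = 0)
    (hθ : ∀ (V : Set N) (X : Π x : N, TangentSpace I x), V ⊆ U → CMDiff[V] ∞ (T% X) →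
      CMDiff[V] ∞ (fun x => θ x (X x)))
    (hΩ : ∀ (V : Set N) (X Y : Π x : N, TangentSpace I x), IsOpen V → V ⊆ U → CMDiff[V] ∞ (T% X) →
      CMDiff[V] ∞ (T% Y) → ∀ x ∈ V, G x (J x (X x)) (Y x) = dOneForm I θ X Y x) :
    IsKahlerOn I G J U := by
  have hJ (V : Set N) (X : Π x : N, TangentSpace I x) (hV : IsOpen V) (hVU : V ⊆ U)
      (hX : CMDiff[V] ∞ (T% X)) : CMDiff[V] ∞ (T% (fun x => J x (X x))) := by
    intro x hx
    obtain ⟨F, W, hxW, h, -⟩ := hF x (hVU hx)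
    have hVW : IsOpen (V ∩ W) := hV.inter h.isOpen
    exact ((h.contMDiffOn_J hE inter_subset_right fun i =>
      hG _ _ _ hVW (inter_subset_left.trans hVU) (hX.mono inter_subset_left)
        ((h.smooth i).mono inter_subset_right)).contMDiffAt
      (hVW.mem_nhds ⟨hx, hxW⟩)).contMDiffWithinAt
  have : CompleteSpace E := FiniteDimensional.complete ℝ E
  refine
    { isOpen := hU
      metric_symm := fun x hx v w => ?_
      metric_pos := fun x hx v hv => ?_
      metric_smooth := hG
      J_sq := fun x hx v => ?_
      J_smooth := hJ
      hermitian := fun x hx v w => ?_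
      integrable := fun V X Y hV hVU hX hY x hx => ?_
      closed := fun V X Y Z hV hVU hX hY hZ x hx =>
        dFundamentalForm_eq_zero_of_eq_dOneForm hV (fun A => hθ V A hVU)
          (fun A B hA hB => hΩ V A B hV hVU hA hB) hX hY hZ hx }
  · obtain ⟨F, W, hxW, h, -⟩ := hF x hx
    exact h.inner_comm hE hxW v w
  · obtain ⟨F, W, hxW, h, -⟩ := hF x hx
    exact h.inner_self_pos hE hxW hv
  · obtain ⟨F, W, hxW, h, -⟩ := hF x hx
    exact h.J_J hE hxW v
  · obtain ⟨F, W, hxW, h, -⟩ := hF x hx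
    exact h.inner_J_J hE hxW v w
  · obtain ⟨F, W, hxW, h, hN⟩ := hF x (hVU hx)
    exact h.nijenhuis_eq_zero hE hxW
      (fun Z hZ => mdifferentiableAt_apply_of_contMDiffOn hU hJ (hVU hx) hZ) hN
      (mdifferentiableAt_of_contMDiffOn hV hX hx) (mdifferentiableAt_of_contMDiffOn hV hY hx)

end HermitianFrame

section ProductField

variable {E : Type*} [NormedAddCommGroup E] [NormedSpace ℝ E]
  {H : Type*} [TopologicalSpace H] {I : ModelWithCorners ℝ E H}
  {M : Type*} [TopologicalSpace M] [ChartedSpace H M]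
  {E' : Type*} [NormedAddCommGroup E'] [NormedSpace ℝ E']
  {H' : Type*} [TopologicalSpace H'] {I' : ModelWithCorners ℝ E' H'}
  {N : Type*} [TopologicalSpace N] [ChartedSpace H' N]

/-- The vector field on `M × N` with components `X` along `M` and `Y` along `N`. -/
def prodField (X : Π p : M, TangentSpace I p) (Y : Π q : N, TangentSpace I' q) (x : M × N) :
    TangentSpace (I.prod I') x :=
  ((X x.1, Y x.2) : E × E')

variable [IsManifold I ∞ M] [IsManifold I' ∞ N]

theorem contMDiffOn_prodField {X : Π p : M, TangentSpace I p} {Y : Π q : N, TangentSpace I' q}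
    {U : Set M} {V : Set N} (hX : CMDiff[U] ∞ (T% X)) (hY : CMDiff[V] ∞ (T% Y)) :
    CMDiff[U ×ˢ V] ∞ (T% (prodField X Y)) :=
  contMDiff_equivTangentBundleProd_symm.comp_contMDiffOn
    ((hX.comp contMDiffOn_fst fun _ hx => hx.1).prodMk (hY.comp contMDiffOn_snd fun _ hx => hx.2))

theorem contMDiffOn_fst_component {Z : Π x : M × N, TangentSpace (I.prod I') x} {W : Set (M × N)}
    (hZ : CMDiff[W] ∞ (T% Z)) : ContMDiffOn (I.prod I') I.tangent ∞
      (fun x => (⟨x.1, (Z x : E × E').1⟩ : TangentBundle I M)) W :=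
  (contMDiff_fst.comp contMDiff_equivTangentBundleProd).comp_contMDiffOn hZ

theorem contMDiffOn_snd_component {Z : Π x : M × ℝ, TangentSpace (I.prod 𝓘(ℝ, ℝ)) x}
    {W : Set (M × ℝ)} (hZ : CMDiff[W] ∞ (T% Z)) :
    ContMDiffOn (I.prod 𝓘(ℝ, ℝ)) 𝓘(ℝ, ℝ) ∞ (fun x => (Z x : E × ℝ).2) W :=
  (contMDiff_snd_tangentBundle_modelSpace ℝ 𝓘(ℝ, ℝ)).comp_contMDiffOn
    ((contMDiff_snd.comp contMDiff_equivTangentBundleProd).comp_contMDiffOn hZ)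

theorem mlieBracket_prodField [CompleteSpace E] [CompleteSpace E'] {U : Set M} {V : Set N}
    (hU : IsOpen U) (hV : IsOpen V) {X₁ X₂ : Π p : M, TangentSpace I p}
    {Y₁ Y₂ : Π q : N, TangentSpace I' q} (hX₁ : CMDiff[U] ∞ (T% X₁)) (hX₂ : CMDiff[U] ∞ (T% X₂))
    (hY₁ : CMDiff[V] ∞ (T% Y₁)) (hY₂ : CMDiff[V] ∞ (T% Y₂)) {x : M × N} (hx : x ∈ U ×ˢ V) :
    mlieBracket (I.prod I') (prodField X₁ Y₁) (prodField X₂ Y₂) x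
      = prodField (mlieBracket I X₁ X₂) (mlieBracket I' Y₁ Y₂) x := by
  have hUV : IsOpen (U ×ˢ V) := hU.prod hV
  have h₁ := contMDiffOn_prodField hX₁ hY₁
  have h₂ := contMDiffOn_prodField hX₂ hY₂
  have hfst := mfderiv_mlieBracket_of_related hUV hU contMDiffOn_fst (fun _ hy => hy.1) h₁ h₂ hX₁
    hX₂ (fun y _ => by rw [mfderiv_fst]; rfl) (fun y _ => by rw [mfderiv_fst]; rfl) hx
  have hsnd := mfderiv_mlieBracket_of_related hUV hV contMDiffOn_snd (fun _ hy => hy.2) h₁ h₂ hY₁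
    hY₂ (fun y _ => by rw [mfderiv_snd]; rfl) (fun y _ => by rw [mfderiv_snd]; rfl) hx
  rw [mfderiv_fst] at hfst
  rw [mfderiv_snd] at hsnd
  exact Prod.ext hfst hsnd

end ProductField

noncomputable section Cone

variable {E : Type*} [NormedAddCommGroup E] [NormedSpace ℝ E]
  {H : Type*} [TopologicalSpace H] {I : ModelWithCorners ℝ E H}
  {M : Type*} [TopologicalSpace M] [ChartedSpace H M]

theorem mvfderiv_apply_eq_fderiv (f : E → ℝ) (p v : E) :
    mvfderiv 𝓘(ℝ, E) f p v = fderiv ℝ f p v := by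
  rw [← mfderiv_eq_fderiv]
  rfl

theorem mvfderiv_comp_snd {f : ℝ → ℝ} {x : M × ℝ} (hf : DifferentiableAt ℝ f x.2)
    (v : TangentSpace (I.prod 𝓘(ℝ, ℝ)) x) :
    mvfderiv (I.prod 𝓘(ℝ, ℝ)) (fun y : M × ℝ => f y.2) x v = deriv f x.2 * (v : E × ℝ).2 := by
  have hcomp := mvfderiv_comp_apply (I' := I.prod 𝓘(ℝ, ℝ)) (f := fun y : M × ℝ => y.2) x
    hf.mdifferentiableAt mdifferentiableAt_snd v
  rw [mfderiv_snd] at hcomp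
  exact hcomp.trans ((mvfderiv_apply_eq_fderiv f x.2 _).trans fderiv_eq_deriv_mul)

/-- The horizontal lift to `M × ℝ` of a vector field `X` on `M`. -/
def horizontalLift (X : Π p : M, TangentSpace I p) :
    Π x : M × ℝ, TangentSpace (I.prod 𝓘(ℝ, ℝ)) x :=
  prodField X 0

/-- The coordinate vector field `∂_t` on `ℝ`. -/
def lineField (t : ℝ) : TangentSpace 𝓘(ℝ, ℝ) t :=
  (1 : ℝ)

variable (I M) in
/-- The coordinate vector field `∂_t` on `M × ℝ`. -/
def verticalField : Π x : M × ℝ, TangentSpace (I.prod 𝓘(ℝ, ℝ)) x :=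
  prodField 0 lineField

theorem contMDiffOn_inv_snd :
    CMDiff[(univ ×ˢ Ioi 0 : Set (M × ℝ))] ∞ (fun x : M × ℝ => x.2⁻¹) := by
  intro x hx
  have hinv : ContDiffAt ℝ ∞ (fun t : ℝ => t⁻¹) x.2 := contDiffAt_inv ℝ (ne_of_gt hx.2)
  exact ContMDiffAt.comp_contMDiffWithinAt x (g := fun t : ℝ => t⁻¹) hinv.contMDiffAt
    contMDiffWithinAt_snd

theorem mdifferentiableAt_inv_snd {x : M × ℝ} (hx : 0 < x.2) :
    MDiffAt (fun x : M × ℝ => x.2⁻¹) x :=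
  mdifferentiableAt_of_contMDiffOn (isOpen_univ.prod isOpen_Ioi) contMDiffOn_inv_snd
    ⟨mem_univ x.1, hx⟩

variable [IsManifold I ∞ M]

theorem contMDiff_zeroField : CMDiff ∞ (T% (0 : Π p : M, TangentSpace I p)) :=
  Bundle.contMDiff_zeroSection ℝ (TangentSpace I)

theorem contMDiffOn_horizontalLift {X : Π p : M, TangentSpace I p} {U : Set M}
    (hX : CMDiff[U] ∞ (T% X)) : CMDiff[U ×ˢ univ] ∞ (T% (horizontalLift X)) :=
  contMDiffOn_prodField hX contMDiff_zeroField.contMDiffOn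

theorem contMDiff_lineField : CMDiff ∞ (T% lineField) :=
  contMDiff_vectorSpace_iff_contDiff.mpr contDiff_const

theorem contMDiff_verticalField : CMDiff ∞ (T% (verticalField I M)) := by
  rw [← contMDiffOn_univ, ← univ_prod_univ]
  exact contMDiffOn_prodField contMDiff_zeroField.contMDiffOn
    contMDiff_lineField.contMDiffOn

section Bracket

variable [CompleteSpace E] {X Y : Π p : M, TangentSpace I p} {U : Set M} {x : M × ℝ}

theorem mlieBracket_horizontalLift (hU : IsOpen U) (hX : CMDiff[U] ∞ (T% X))
    (hY : CMDiff[U] ∞ (T% Y)) (hx : x.1 ∈ U) :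
    mlieBracket (I.prod 𝓘(ℝ, ℝ)) (horizontalLift X) (horizontalLift Y) x
      = horizontalLift (mlieBracket I X Y) x := by
  refine (mlieBracket_prodField hU isOpen_univ hX hY contMDiff_zeroField.contMDiffOn
    contMDiff_zeroField.contMDiffOn ⟨hx, mem_univ _⟩).trans ?_
  rw [horizontalLift, mlieBracket_self]

theorem mlieBracket_horizontalLift_verticalField (hU : IsOpen U) (hX : CMDiff[U] ∞ (T% X))
    (hx : x.1 ∈ U) :
    mlieBracket (I.prod 𝓘(ℝ, ℝ)) (horizontalLift X) (verticalField I M) x = 0 := by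
  refine (mlieBracket_prodField hU isOpen_univ hX
    contMDiff_zeroField.contMDiffOn
    contMDiff_zeroField.contMDiffOn
    contMDiff_lineField.contMDiffOn ⟨hx, mem_univ _⟩).trans ?_
  rw [mlieBracket_zero_right, mlieBracket_zero_left]
  rfl

theorem mlieBracket_inv_smul_horizontalLift (hU : IsOpen U) (hX : CMDiff[U] ∞ (T% X))
    (hY : CMDiff[U] ∞ (T% Y)) (hx : x.1 ∈ U) (hx' : 0 < x.2) :
    mlieBracket (I.prod 𝓘(ℝ, ℝ)) ((fun x : M × ℝ => x.2⁻¹) • horizontalLift X)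
        ((fun x : M × ℝ => x.2⁻¹) • horizontalLift Y) x
      = x.2⁻¹ • x.2⁻¹ • horizontalLift (mlieBracket I X Y) x := by
  have hd {Z : Π p : M, TangentSpace I p} (hZ : CMDiff[U] ∞ (T% Z)) :
      MDiffAt (T% (horizontalLift Z)) x :=
    mdifferentiableAt_of_contMDiffOn (hU.prod isOpen_univ) (contMDiffOn_horizontalLift hZ)
      ⟨hx, mem_univ _⟩
  have ht := mdifferentiableAt_inv_snd (I := I) hx'
  have hzero (Z : Π p : M, TangentSpace I p) :
      mvfderiv (I.prod 𝓘(ℝ, ℝ)) (fun x : M × ℝ => x.2⁻¹) x (horizontalLift Z x) = 0 :=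
    (mvfderiv_comp_snd (differentiableAt_inv hx'.ne') _).trans (mul_zero _)
  rw [mlieBracket_smul_left ht (hd hX), mlieBracket_smul_right ht (hd hY), Pi.smul_apply', map_smul,
    hzero, hzero, mlieBracket_horizontalLift hU hX hY hx]
  simp

theorem mlieBracket_inv_smul_horizontalLift_verticalField (hU : IsOpen U)
    (hX : CMDiff[U] ∞ (T% X)) (hx : x.1 ∈ U) (hx' : 0 < x.2) (a : ℝ) :
    mlieBracket (I.prod 𝓘(ℝ, ℝ)) ((fun x : M × ℝ => x.2⁻¹) • horizontalLift X)
        (a • verticalField I M) x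
      = (a / x.2) • x.2⁻¹ • horizontalLift X x := by
  have hd : MDiffAt (T% (horizontalLift X)) x :=
    mdifferentiableAt_of_contMDiffOn (hU.prod isOpen_univ) (contMDiffOn_horizontalLift hX)
      ⟨hx, mem_univ _⟩
  have hv : MDiffAt (T% (verticalField I M)) x :=
    contMDiff_verticalField.mdifferentiableAt (by simp)
  have hinv : mvfderiv (I.prod 𝓘(ℝ, ℝ)) (fun x : M × ℝ => x.2⁻¹) x (verticalField I M x)
      = -(x.2 ^ 2)⁻¹ :=
    (mvfderiv_comp_snd (differentiableAt_inv hx'.ne') _).trans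
      ((mul_one _).trans (congrFun deriv_inv' _))
  rw [mlieBracket_const_smul_right hv, mlieBracket_smul_left (mdifferentiableAt_inv_snd hx') hd,
    mlieBracket_horizontalLift_verticalField hU hX hx, hinv]
  module

end Bracket

end Cone

section ConeBrackets

variable {E : Type*} [NormedAddCommGroup E] [NormedSpace ℝ E]
  {H : Type*} [TopologicalSpace H] {I : ModelWithCorners ℝ E H}
  {N : Type*} [TopologicalSpace N] [ChartedSpace H N]

/-- The bracket relations at `x` of the orthonormal frame `e₀/t, e₁/t, e₂/t, √c ∂_t` of the cone
over a 3-manifold, where `e₀` is a Killing field: `σ` is `√c / t` and `β` comes from the angular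
velocity of the frame along `e₀`. The components of `[F₁, F₂]` other than the `F₀`-component do not
enter the Kähler condition and are left free. -/
structure HasConeBrackets (G : Π x : N, TangentSpace I x →L[ℝ] TangentSpace I x →L[ℝ] ℝ)
    (F : Fin 4 → Π x : N, TangentSpace I x) (x : N) (σ β : ℝ) : Prop where
  zero_one : mlieBracket I (F 0) (F 1) x = β • F 2 x
  zero_two : mlieBracket I (F 0) (F 2) x = -(β • F 1 x)
  inner_one_two : G x (mlieBracket I (F 1) (F 2) x) (F 0 x) = 2 * σ
  castSucc_last : ∀ i : Fin 3,
    mlieBracket I (F i.castSucc) (F (Fin.last 3)) x = σ • F i.castSucc x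

variable [IsManifold I ∞ N] {G : Π x : N, TangentSpace I x →L[ℝ] TangentSpace I x →L[ℝ] ℝ}
  {J : Π x : N, TangentSpace I x →L[ℝ] TangentSpace I x}
  {F : Fin 4 → Π x : N, TangentSpace I x} {W : Set N} {x : N} {σ β : ℝ}

theorem IsHermitianFrameOn.nijenhuis_zero_one (h : IsHermitianFrameOn G J F W) (hx : x ∈ W)
    (hb : HasConeBrackets G F x σ β) : nijenhuis I J (F 0) (F 1) x = 0 := by
  have hW : ∀ᶠ y in 𝓝 x, y ∈ W := h.isOpen.mem_nhds hx
  have hJ₀ : (fun y => J y (F 0 y)) =ᶠ[𝓝 x] F 3 := hW.mono h.J_zero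
  have hJ₁ : (fun y => J y (F 1 y)) =ᶠ[𝓝 x] F 2 := hW.mono h.J_one
  have h₃ (i : Fin 3) : mlieBracket I (F 3) (F i.castSucc) x = -(σ • F i.castSucc x) := by
    rw [mlieBracket_swap_apply]
    exact congrArg Neg.neg (hb.castSucc_last i)
  have h₃₁ : mlieBracket I (F 3) (F 1) x = -(σ • F 1 x) := h₃ 1
  have h₃₂ : mlieBracket I (F 3) (F 2) x = -(σ • F 2 x) := h₃ 2
  have hJ₀F₁ : mlieBracket I (fun y => J y (F 0 y)) (F 1) x = mlieBracket I (F 3) (F 1) x :=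
    hJ₀.mlieBracket_vectorField_eq (Filter.EventuallyEq.refl (𝓝 x) (F 1))
  have hF₀J₁ : mlieBracket I (F 0) (fun y => J y (F 1 y)) x = mlieBracket I (F 0) (F 2) x :=
    (Filter.EventuallyEq.refl (𝓝 x) (F 0)).mlieBracket_vectorField_eq hJ₁
  rw [nijenhuis, hJ₀.mlieBracket_vectorField_eq hJ₁, hJ₀F₁, hF₀J₁, hb.zero_one, hb.zero_two,
    h₃₁, h₃₂]
  simp only [map_neg, map_smul, h.J_one x hx]
  module

theorem HasConeBrackets.sum_inner_mlieBracket (h : IsOrthonormalOn G F W) (hx : x ∈ W)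
    (hb : HasConeBrackets G F x σ β) (a b : Fin 4 → ℝ) :
    ∑ i, ∑ k, a i * b k * G x (mlieBracket I (F i) (F k) x) (F 0 x)
      = σ * (a 0 * b 3 - a 3 * b 0 + 2 * (a 1 * b 2 - a 2 * b 1)) := by
  have h₀₃ : mlieBracket I (F 0) (F 3) x = σ • F 0 x := hb.castSucc_last 0
  have h₁₃ : mlieBracket I (F 1) (F 3) x = σ • F 1 x := hb.castSucc_last 1
  have h₂₃ : mlieBracket I (F 2) (F 3) x = σ • F 2 x := hb.castSucc_last 2
  have hself (i : Fin 4) : mlieBracket I (F i) (F i) x = 0 := by simp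
  simp only [Fin.sum_univ_four, hself, mlieBracket_swap_apply (V := F 1) (W := F 0),
    mlieBracket_swap_apply (V := F 2) (W := F 0), mlieBracket_swap_apply (V := F 3) (W := F 0),
    mlieBracket_swap_apply (V := F 2) (W := F 1), mlieBracket_swap_apply (V := F 3) (W := F 1),
    mlieBracket_swap_apply (V := F 3) (W := F 2), hb.zero_one, hb.zero_two, h₀₃, h₁₃, h₂₃,
    map_neg, map_smul, map_zero, neg_apply, smul_apply, zero_apply, hb.inner_one_two,
    h.inner_eq x hx, Fin.reduceEq, if_false, if_true, smul_eq_mul]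
  ring

theorem IsHermitianFrameOn.inner_J_eq_dOneForm [FiniteDimensional ℝ E]
    (h : IsHermitianFrameOn G J F W) (hE : Module.finrank ℝ E = 4) (hx : x ∈ W)
    (hb : HasConeBrackets G F x σ β) {r : N → ℝ} (hr : MDiffAt r x) (hrσ : r x * σ = -(1 / 2))
    (hdr : ∀ v, mvfderiv I r x v = -(1 / 2) * G x v (F 3 x)) {θ : Π x : N, TangentSpace I x →L[ℝ] ℝ}
    (hθ : ∀ y ∈ W, ∀ v, θ y v = r y * G y v (F 0 y)) {X Y : Π x : N, TangentSpace I x}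
    (hX : ∀ i, MDiffAt (fun y => G y (X y) (F i y)) x)
    (hY : ∀ i, MDiffAt (fun y => G y (Y y) (F i y)) x) :
    G x (J x (X x)) (Y x) = dOneForm I θ X Y x := by
  have hθZ {Z : Π x : N, TangentSpace I x} (hZ : MDiffAt (fun y => G y (Z y) (F 0 y)) x)
      (v : TangentSpace I x) : mvfderiv I (fun y => θ y (Z y)) x v
        = r x * mvfderiv I (fun y => G y (Z y) (F 0 y)) x v
          - 1 / 2 * G x (Z x) (F 0 x) * G x v (F 3 x) := by
    have hloc : (fun y => θ y (Z y)) =ᶠ[𝓝 x] r * fun y => G y (Z y) (F 0 y) := by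
      filter_upwards [h.isOpen.mem_nhds hx] with y hy using hθ y hy (Z y)
    rw [mvfderiv_congr_of_eventuallyEq hloc, mvfderiv_mul hr hZ, add_apply, smul_apply, smul_apply,
      hdr, smul_eq_mul, smul_eq_mul]
    ring
  rw [dOneForm, hθZ (hX 0), hθZ (hY 0), hθ x hx, h.inner_mlieBracket hE hx hX hY,
    hb.sum_inner_mlieBracket h.toIsOrthonormalOn hx, h.inner_J_apply hE hx]
  linear_combination (G x (X x) (F 0 x) * G x (Y x) (F 3 x) - G x (X x) (F 3 x) * G x (Y x) (F 0 x)
    + 2 * (G x (X x) (F 1 x) * G x (Y x) (F 2 x) - G x (X x) (F 2 x) * G x (Y x) (F 1 x))) * hrσ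

end ConeBrackets

noncomputable section ConeMetric

variable {E : Type*} [NormedAddCommGroup E] [NormedSpace ℝ E]
  {H : Type*} [TopologicalSpace H] {I : ModelWithCorners ℝ E H}
  {M : Type*} [TopologicalSpace M] [ChartedSpace H M]

/-- The frame `e₀/t, e₁/t, e₂/t, √c ∂_t` of the cone. -/
def coneFrame (e : Fin 3 → Π p : M, TangentSpace I p) (c : ℝ) :
    Fin 4 → Π x : M × ℝ, TangentSpace (I.prod 𝓘(ℝ, ℝ)) x :=
  Fin.snoc (α := fun _ => Π x : M × ℝ, TangentSpace (I.prod 𝓘(ℝ, ℝ)) x)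
    (fun i => (fun x : M × ℝ => x.2⁻¹) • horizontalLift (e i)) (√c • verticalField I M)

theorem coneFrame_castSucc (e : Fin 3 → Π p : M, TangentSpace I p) (c : ℝ) (i : Fin 3) :
    coneFrame e c i.castSucc = (fun x : M × ℝ => x.2⁻¹) • horizontalLift (e i) :=
  Fin.snoc_castSucc (α := fun _ => Π x : M × ℝ, TangentSpace (I.prod 𝓘(ℝ, ℝ)) x) _ _ i

theorem coneFrame_last (e : Fin 3 → Π p : M, TangentSpace I p) (c : ℝ) :
    coneFrame e c (Fin.last 3) = √c • verticalField I M :=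
  Fin.snoc_last (α := fun _ => Π x : M × ℝ, TangentSpace (I.prod 𝓘(ℝ, ℝ)) x) _ _

variable [IsManifold I ∞ M]
  {g : Bundle.ContMDiffRiemannianMetric I ∞ E (fun p : M => TangentSpace I p)} {c : ℝ}

theorem coneMetric_apply (x : M × ℝ) (v w : TangentSpace (I.prod 𝓘(ℝ, ℝ)) x) :
    coneMetric g c x v w = x.2 ^ 2 * g.inner x.1 (v : E × ℝ).1 (w : E × ℝ).1
      + 1 / c * ((v : E × ℝ).2 * (w : E × ℝ).2) :=
  rfl

theorem coneMetric_horizontalLift (x : M × ℝ) (X Y : Π p : M, TangentSpace I p) :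
    coneMetric g c x (horizontalLift X x) (horizontalLift Y x)
      = x.2 ^ 2 * g.inner x.1 (X x.1) (Y x.1) := by
  have hvert : (horizontalLift Y x : E × ℝ).2 = 0 := rfl
  rw [coneMetric_apply, hvert, mul_zero, mul_zero, add_zero]
  rfl

theorem coneMetric_verticalField_right (x : M × ℝ) (v : TangentSpace (I.prod 𝓘(ℝ, ℝ)) x) :
    coneMetric g c x v (verticalField I M x) = 1 / c * (v : E × ℝ).2 := by
  have hhor : (verticalField I M x : E × ℝ).1 = 0 := rfl
  have hvert : (verticalField I M x : E × ℝ).2 = 1 := rfl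
  rw [coneMetric_apply, hhor, hvert, mul_one]
  exact add_eq_right.mpr ((congrArg _ (map_zero _)).trans (mul_zero _))

theorem coneMetric_comm (x : M × ℝ) (v w : TangentSpace (I.prod 𝓘(ℝ, ℝ)) x) :
    coneMetric g c x v w = coneMetric g c x w v :=
  congrArg₂ (· + ·) (congrArg (x.2 ^ 2 * ·) (g.symm x.1 _ _)) (congrArg (1 / c * ·) (mul_comm _ _))

theorem contMDiffOn_coneMetric {X Y : Π x : M × ℝ, TangentSpace (I.prod 𝓘(ℝ, ℝ)) x}
    {V : Set (M × ℝ)} (hX : CMDiff[V] ∞ (T% X)) (hY : CMDiff[V] ∞ (T% Y)) :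
    CMDiff[V] ∞ (fun x => coneMetric g c x (X x) (Y x)) := by
  have ht : CMDiff[V] ∞ (fun x : M × ℝ => x.2) := contMDiffOn_snd
  have hhor := contMDiffOn_inner (g := g) (contMDiffOn_fst_component hX)
    (contMDiffOn_fst_component hY)
  have hvert := (contMDiffOn_snd_component hX).mul (contMDiffOn_snd_component hY)
  exact ((ht.pow 2).mul hhor).add
    ((contMDiffOn_const (c := 1 / c) (I' := 𝓘(ℝ, ℝ))).mul hvert)

section ComplexStructure

variable {ξ : Π p : M, TangentSpace I p} {j : Π p : M, TangentSpace I p →L[ℝ] TangentSpace I p}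
  {x : M × ℝ}

theorem coneJ_horizontalLift {X : Π p : M, TangentSpace I p}
    (hX : g.inner x.1 (ξ x.1) (X x.1) = 0) :
    coneJ g ξ c j x (horizontalLift X x) = horizontalLift (fun p => j p (X p)) x := by
  refine Prod.ext ?_ ?_
  · change j x.1 (X x.1) - (1 / (x.2 * √c)) • (0 : ℝ) • ξ x.1 = j x.1 (X x.1)
    rw [zero_smul, smul_zero, sub_zero]
  · change x.2 * √c * g.inner x.1 (ξ x.1) (X x.1) = 0
    rw [hX, mul_zero]

theorem coneJ_horizontalLift_self (hξ : g.inner x.1 (ξ x.1) (ξ x.1) = 1)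
    (hj : j x.1 (ξ x.1) = 0) :
    coneJ g ξ c j x (horizontalLift ξ x) = (x.2 * √c) • verticalField I M x := by
  refine Prod.ext ?_ ?_
  · change j x.1 (ξ x.1) - (1 / (x.2 * √c)) • (0 : ℝ) • ξ x.1 = (x.2 * √c) • (0 : E)
    rw [hj, zero_smul, smul_zero, sub_zero]
    exact (smul_zero _).symm
  · change x.2 * √c * g.inner x.1 (ξ x.1) (ξ x.1) = x.2 * √c * 1
    rw [hξ]

theorem coneJ_verticalField :
    coneJ g ξ c j x (verticalField I M x) = -((1 / (x.2 * √c)) • horizontalLift ξ x) := by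
  refine Prod.ext ?_ ?_
  · change j x.1 0 - (1 / (x.2 * √c)) • (1 : ℝ) • ξ x.1 = -((1 / (x.2 * √c)) • ξ x.1)
    rw [map_zero, one_smul, zero_sub]
  · change x.2 * √c * g.inner x.1 (ξ x.1) 0 = -((1 / (x.2 * √c)) * (0 : ℝ))
    rw [map_zero, mul_zero, mul_zero, neg_zero]

end ComplexStructure

variable {e : Fin 3 → Π p : M, TangentSpace I p} {U : Set M}

theorem isOrthonormalOn_inv_smul_horizontalLift (h : IsOrthonormalOn g.inner e U) :
    IsOrthonormalOn (coneMetric g c)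
      (fun i => (fun x : M × ℝ => x.2⁻¹) • horizontalLift (e i)) (U ×ˢ Ioi 0) where
  isOpen := h.isOpen.prod isOpen_Ioi
  smooth i := (contMDiffOn_inv_snd.mono (prod_mono_left (subset_univ U))).smul_section
    ((contMDiffOn_horizontalLift (h.smooth i)).mono (prod_mono_right (subset_univ _)))
  inner_eq x hx i k := by
    have ht : x.2 ≠ 0 := ne_of_gt hx.2
    rw [Pi.smul_apply', Pi.smul_apply', map_smul, map_smul, smul_apply, coneMetric_horizontalLift,
      h.inner_eq x.1 hx.1, smul_eq_mul, smul_eq_mul]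
    field_simp

theorem isOrthonormalOn_coneFrame (h : IsOrthonormalOn g.inner e U) (hc : 0 < c) :
    IsOrthonormalOn (coneMetric g c) (coneFrame e c) (U ×ˢ Ioi 0) := by
  have horth (x : M × ℝ) (i : Fin 3) : coneMetric g c x (((fun x : M × ℝ => x.2⁻¹)
      • horizontalLift (e i)) x) ((√c • verticalField I M) x) = 0 := by
    have hinner : coneMetric g c x (horizontalLift (e i) x) (verticalField I M x) = 1 / c * 0 :=
      coneMetric_verticalField_right ..
    rw [Pi.smul_apply', Pi.smul_apply, map_smul, map_smul, smul_apply, hinner, mul_zero, smul_zero,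
      smul_zero]
  refine (isOrthonormalOn_inv_smul_horizontalLift h).snoc
    contMDiff_verticalField.contMDiffOn.const_smul_section (fun x _ => ?_)
    (fun x _ i => (coneMetric_comm ..).trans (horth x i)) fun x _ i => horth x i
  have hinner : coneMetric g c x (verticalField I M x) (verticalField I M x) = 1 / c * 1 :=
    coneMetric_verticalField_right ..
  rw [Pi.smul_apply, map_smul, map_smul, smul_apply, hinner, smul_eq_mul, smul_eq_mul]
  field_simp
  exact Real.sq_sqrt hc.le

theorem isHermitianFrameOn_coneFrame (h : IsOrthonormalOn g.inner e U) (hc : 0 < c)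
    {j : Π p : M, TangentSpace I p →L[ℝ] TangentSpace I p} (hj : ∀ p ∈ U, j p = frameRot g e p) :
    IsHermitianFrameOn (coneMetric g c) (coneJ g (e 0) c j) (coneFrame e c) (U ×ˢ Ioi 0) := by
  have hF₀ : coneFrame e c 0 = _ := coneFrame_castSucc e c 0
  have hF₁ : coneFrame e c 1 = _ := coneFrame_castSucc e c 1
  have hF₂ : coneFrame e c 2 = _ := coneFrame_castSucc e c 2
  have hF₃ : coneFrame e c 3 = _ := coneFrame_last e c
  have hsqrt : √c ≠ 0 := Real.sqrt_ne_zero'.mpr hc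
  refine { isOrthonormalOn_coneFrame h hc with
    J_zero := fun x hx => ?_
    J_one := fun x hx => ?_
    J_two := fun x hx => ?_
    J_three := fun x hx => ?_ }
  all_goals
    have ht : x.2 ≠ 0 := ne_of_gt hx.2
    have hjx := hj x.1 hx.1
  · rw [hF₀, hF₃, Pi.smul_apply', Pi.smul_apply, map_smul,
      coneJ_horizontalLift_self (h.inner_eq x.1 hx.1 0 0) (hjx ▸ h.frameRot_zero hx.1), smul_smul,
      inv_mul_cancel_left₀ ht]
  · rw [hF₁, hF₂, Pi.smul_apply', Pi.smul_apply', map_smul,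
      coneJ_horizontalLift (h.inner_eq x.1 hx.1 0 1)]
    have hrot : j x.1 (e 1 x.1) = e 2 x.1 := by rw [hjx, h.frameRot_one hx.1]
    exact congrArg (x.2⁻¹ • ·) (Prod.ext hrot rfl)
  · rw [hF₁, hF₂, Pi.smul_apply', Pi.smul_apply', map_smul,
      coneJ_horizontalLift (h.inner_eq x.1 hx.1 0 2)]
    have hrot : j x.1 (e 2 x.1) = -e 1 x.1 := by rw [hjx, h.frameRot_two hx.1]
    have hlift : horizontalLift (fun p => j p (e 2 p)) x = -horizontalLift (e 1) x :=
      Prod.ext hrot (neg_zero (G := ℝ)).symm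
    rw [hlift, smul_neg]
  · rw [hF₀, hF₃, Pi.smul_apply', Pi.smul_apply, map_smul, coneJ_verticalField, smul_neg, smul_smul]
    congr 2
    field_simp

theorem hasConeBrackets_coneFrame [FiniteDimensional ℝ E] (h : IsOrthonormalOn g.inner e U)
    (hE : Module.finrank ℝ E = 3) (hkill : IsKilling g (e 0)) {x : M × ℝ} (hx : x ∈ U ×ˢ Ioi 0)
    (htwist : frameTwist g e x.1 = -√c) :
    HasConeBrackets (coneMetric g c) (coneFrame e c) x (√c / x.2) (frameSpin g e x.1 / x.2) := by
  have : CompleteSpace E := FiniteDimensional.complete ℝ E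
  have ht : x.2 ≠ 0 := ne_of_gt hx.2
  have hF₀ : coneFrame e c 0 = _ := coneFrame_castSucc e c 0
  have hF₁ : coneFrame e c 1 = _ := coneFrame_castSucc e c 1
  have hF₂ : coneFrame e c 2 = _ := coneFrame_castSucc e c 2
  have hbracket (i k : Fin 3) := mlieBracket_inv_smul_horizontalLift h.isOpen (h.smooth i)
    (h.smooth k) hx.1 hx.2
  refine ⟨?_, ?_, ?_, fun i => ?_⟩
  · have hlift : horizontalLift (mlieBracket I (e 0) (e 1)) x
        = frameSpin g e x.1 • horizontalLift (e 2) x :=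
      Prod.ext (h.mlieBracket_zero_one hE hkill hx.1) (mul_zero (frameSpin g e x.1)).symm
    rw [hF₀, hF₁, hF₂, hbracket, hlift, Pi.smul_apply']
    module
  · have hlift : horizontalLift (mlieBracket I (e 0) (e 2)) x
        = -(frameSpin g e x.1 • horizontalLift (e 1) x) :=
      Prod.ext (h.mlieBracket_zero_two hE hkill hx.1)
        (neg_eq_zero.mpr (mul_zero (frameSpin g e x.1))).symm
    rw [hF₀, hF₁, hF₂, hbracket, hlift, Pi.smul_apply']
    module
  · have htwist' : g.inner x.1 (mlieBracket I (e 1) (e 2) x.1) (e 0 x.1) = 2 * √c := by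
      rw [frameTwist] at htwist
      linarith
    rw [hF₀, hF₁, hF₂, hbracket, Pi.smul_apply', map_smul, map_smul, map_smul, smul_apply,
      smul_apply, coneMetric_horizontalLift, htwist', smul_eq_mul, smul_eq_mul, smul_eq_mul]
    field_simp
  · rw [coneFrame_castSucc, coneFrame_last]
    exact mlieBracket_inv_smul_horizontalLift_verticalField h.isOpen (h.smooth i) hx.1 hx.2 _

/-- The primitive `-t² ξ♭ / (2√c)` of the fundamental form of the cone, with `t² ξ♭` written as the
form dual to the lift of `ξ` under the cone metric. -/
def conePotential (g : Bundle.ContMDiffRiemannianMetric I ∞ E (fun p : M => TangentSpace I p))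
    (ξ : Π p : M, TangentSpace I p) (c : ℝ) (x : M × ℝ) :
    TangentSpace (I.prod 𝓘(ℝ, ℝ)) x →L[ℝ] ℝ :=
  -(1 / (2 * √c)) • coneMetric g c x (horizontalLift ξ x)

theorem contMDiffOn_conePotential {ξ : Π p : M, TangentSpace I p} {O : Set M}
    (hξ : CMDiff[O] ∞ (T% ξ)) {V : Set (M × ℝ)} (hV : V ⊆ O ×ˢ univ)
    {X : Π x : M × ℝ, TangentSpace (I.prod 𝓘(ℝ, ℝ)) x} (hX : CMDiff[V] ∞ (T% X)) :
    CMDiff[V] ∞ (fun x => conePotential g ξ c x (X x)) :=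
  (contMDiffOn_const (c := -(1 / (2 * √c))) (I' := 𝓘(ℝ, ℝ))).mul
    (contMDiffOn_coneMetric ((contMDiffOn_horizontalLift hξ).mono hV) hX)

theorem inner_coneJ_eq_dOneForm_conePotential [FiniteDimensional ℝ E]
    (h : IsOrthonormalOn g.inner e U) (hE : Module.finrank ℝ E = 3) (hkill : IsKilling g (e 0))
    (hc : 0 < c) {j : Π p : M, TangentSpace I p →L[ℝ] TangentSpace I p}
    (hj : ∀ p ∈ U, j p = frameRot g e p) {x : M × ℝ} (hx : x ∈ U ×ˢ Ioi 0)
    (htwist : frameTwist g e x.1 = -√c) {V : Set (M × ℝ)} (hV : IsOpen V) (hxV : x ∈ V)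
    {X Y : Π x : M × ℝ, TangentSpace (I.prod 𝓘(ℝ, ℝ)) x} (hX : CMDiff[V] ∞ (T% X))
    (hY : CMDiff[V] ∞ (T% Y)) :
    coneMetric g c x (coneJ g (e 0) c j x (X x)) (Y x)
      = dOneForm (I.prod 𝓘(ℝ, ℝ)) (conePotential g (e 0) c) X Y x := by
  have hsqrt : √c ≠ 0 := Real.sqrt_ne_zero'.mpr hc
  have hF := isHermitianFrameOn_coneFrame h hc hj
  have hdim : Module.finrank ℝ (E × ℝ) = 4 := by rw [Module.finrank_prod, hE, Module.finrank_self]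
  have hr : DifferentiableAt ℝ (fun t : ℝ => -(1 / (2 * √c)) * t) x.2 := by fun_prop
  have hcomp {Z : Π x : M × ℝ, TangentSpace (I.prod 𝓘(ℝ, ℝ)) x} (hZ : CMDiff[V] ∞ (T% Z))
      (i : Fin 4) : MDiffAt (fun y => coneMetric g c y (Z y) (coneFrame e c i y)) x :=
    mdifferentiableAt_of_contMDiffOn (hV.inter hF.isOpen) (contMDiffOn_coneMetric
      (hZ.mono inter_subset_left) ((hF.smooth i).mono inter_subset_right)) ⟨hxV, hx⟩
  refine hF.inner_J_eq_dOneForm hdim hx (hasConeBrackets_coneFrame h hE hkill hx htwist)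
    (r := fun y => -(1 / (2 * √c)) * y.2)
    (hr.mdifferentiableAt.comp x mdifferentiableAt_snd) ?_ (fun v => ?_) (fun y hy v => ?_)
    (hcomp hX) (hcomp hY)
  · have ht : x.2 ≠ 0 := ne_of_gt hx.2
    field_simp
  · have hF₃ : coneFrame e c 3 = _ := coneFrame_last e c
    rw [mvfderiv_comp_snd hr, hF₃, Pi.smul_apply, map_smul, coneMetric_verticalField_right,
      deriv_const_mul_field, deriv_id'', smul_eq_mul]
    field_simp
    rw [Real.sq_sqrt hc.le, mul_comm]
  · have ht : y.2 ≠ 0 := ne_of_gt hy.2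
    have hF₀ : coneFrame e c 0 = _ := coneFrame_castSucc e c 0
    rw [hF₀, Pi.smul_apply', map_smul, conePotential, smul_apply, coneMetric_comm, smul_eq_mul,
      smul_eq_mul, mul_assoc, mul_inv_cancel_left₀ ht]

theorem isKahlerOn_cone [FiniteDimensional ℝ E] (hE : Module.finrank ℝ E = 3)
    {ξ : Π p : M, TangentSpace I p} (hξ : CMDiff ∞ (T% ξ))
    (hunit : ∀ p, g.inner p (ξ p) (ξ p) = 1) (hkill : IsKilling g ξ)
    {j : Π p : M, TangentSpace I p →L[ℝ] TangentSpace I p} (hj : IsTransverseRotation g ξ j)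
    {O : Set M} (hO : IsOpen O) (hpos : ∀ p ∈ O, 0 < ricciFunction g ξ p)
    (hric : ∀ p ∈ O, ricciFunction g ξ p = c) :
    IsKahlerOn (I.prod 𝓘(ℝ, ℝ)) (coneMetric g c) (coneJ g ξ c j) (O ×ˢ Ioi 0) := by
  have hdim : Module.finrank ℝ (E × ℝ) = 4 := by rw [Module.finrank_prod, hE, Module.finrank_self]
  have hframe (p : M) (hp : p ∈ O) : 0 < c ∧ ∃ e U, p ∈ U ∧ IsOrthonormalOn g.inner e U ∧ e 0 = ξ ∧
      (∀ q ∈ U, j q = frameRot g e q) ∧ frameTwist g e p = -√c := by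
    obtain ⟨e, U, hpU, h⟩ :=
      exists_isAdaptedFrameOn hE hξ hunit hkill (hpos p hp)
    exact ⟨hric p hp ▸ hpos p hp, e, U, hpU, h.toIsOrthonormalOn, h.zero_eq, hj e U h,
      by rw [h.frameTwist_eq hE hkill hpU, hric p hp]⟩
  refine isKahlerOn_of_isHermitianFrameOn hdim (θ := conePotential g ξ c) (hO.prod isOpen_Ioi)
    (fun V X Y _ _ hX hY => contMDiffOn_coneMetric hX hY) (fun x hx => ?_)
    (fun V X hV hX => contMDiffOn_conePotential hξ.contMDiffOn
      (hV.trans (prod_mono_right (subset_univ _))) hX) fun V X Y hV hVU hX hY x hx => ?_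
  · obtain ⟨hc, e, U, hxU, h, rfl, hjU, htwist⟩ := hframe x.1 hx.1
    have hF := isHermitianFrameOn_coneFrame h hc hjU
    exact ⟨coneFrame e c, U ×ˢ Ioi 0, ⟨hxU, hx.2⟩, hF, hF.nijenhuis_zero_one ⟨hxU, hx.2⟩
      (hasConeBrackets_coneFrame h hE hkill ⟨hxU, hx.2⟩ htwist)⟩
  · obtain ⟨hc, e, U, hxU, h, rfl, hjU, htwist⟩ := hframe x.1 (hVU hx).1
    exact inner_coneJ_eq_dOneForm_conePotential h hE hkill hc hjU ⟨hxU, (hVU hx).2⟩ htwist hV hx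
      hX hY

end ConeMetric

end SasakiCone

theorem proposition1_general {E : Type*} [NormedAddCommGroup E] [NormedSpace ℝ E]
    [FiniteDimensional ℝ E] {H : Type*} [TopologicalSpace H] {I : ModelWithCorners ℝ E H}
    {M : Type*} [TopologicalSpace M] [ChartedSpace H M] [IsManifold I ∞ M]
    {g : Bundle.ContMDiffRiemannianMetric I ∞ E (fun p : M => TangentSpace I p)}
    {ξ : Π p : M, TangentSpace I p} (hE : Module.finrank ℝ E = 3) (hξ : CMDiff ∞ (T% ξ))
    (hunit : ∀ p, g.inner p (ξ p) (ξ p) = 1) (hkill : SasakiCone.IsKilling g ξ)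
    (hpos : ∀ p, 0 < SasakiCone.ricciFunction g ξ p) {O : Set M} (hO : IsOpen O) {c : ℝ}
    (hc : ∀ p ∈ O, SasakiCone.ricciFunction g ξ p = c) :
    ∃ j : Π p : M, TangentSpace I p →L[ℝ] TangentSpace I p,
      SasakiCone.IsTransverseComplexStructure g ξ j ∧
      SasakiCone.IsKahlerOn (I.prod 𝓘(ℝ, ℝ))
        (SasakiCone.coneMetric g c) (SasakiCone.coneJ g ξ c j) (O ×ˢ Set.Ioi (0 : ℝ)) := by
  obtain ⟨j, hj⟩ := SasakiCone.exists_isTransverseRotation hE hξ hunit hkill hpos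
  exact ⟨j, hj.isTransverseComplexStructure hE hξ hunit hkill hpos,
    SasakiCone.isKahlerOn_cone hE hξ hunit hkill hj hO (fun p _ => hpos p) hc⟩

theorem proposition1 {M : Type*} [TopologicalSpace M] [T2Space M] [CompactSpace M]
    [ChartedSpace (EuclideanSpace ℝ (Fin 3)) M] [IsManifold (𝓡 3) ∞ M]
    (g : Bundle.ContMDiffRiemannianMetric (𝓡 3) ∞ (EuclideanSpace ℝ (Fin 3))
      (fun p : M => TangentSpace (𝓡 3) p))
    (ξ : Π p : M, TangentSpace (𝓡 3) p)
    (hξ : ContMDiff (𝓡 3) (𝓡 3).tangent ∞ (T% ξ))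
    (hunit : ∀ p, g.inner p (ξ p) (ξ p) = 1)
    (hgeo : ∀ p, SasakiCone.leviCivita g ξ ξ p = 0)
    (hkill : SasakiCone.IsKilling g ξ)
    (hpos : ∀ p, 0 < SasakiCone.ricciFunction g ξ p)
    (P₀ : M) (K : Set M) (hK : IsCompact K) (hP₀ : P₀ ∉ K)
    (c : ℝ) (hc : ∀ p, p ∉ K → SasakiCone.ricciFunction g ξ p = c) :
    ∃ j : Π p : M, TangentSpace (𝓡 3) p →L[ℝ] TangentSpace (𝓡 3) p,
      SasakiCone.IsTransverseComplexStructure g ξ j ∧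
      SasakiCone.IsKahlerOn ((𝓡 3).prod 𝓘(ℝ, ℝ))
        (SasakiCone.coneMetric g c) (SasakiCone.coneJ g ξ c j) (Kᶜ ×ˢ Set.Ioi (0 : ℝ)) :=
  proposition1_general finrank_euclideanSpace_fin hξ hunit hkill hpos hK.isClosed.isOpen_compl hc
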